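/- For functions $\psi,\theta:\mathbb N\to\mathbb R_{\ge 0}$, positive integers $v,w$ and real $t\ge 1$ write $$D_{\psi,\theta}(v,w)=\frac{\max(w\,\psi(v),\,v\,\theta(w))}{\gcd(v,w)},\qquad \omega_t(v,w)=\#\Big\{p\le t \text{ prime}:\ p\ \Big|\ \frac{vw}{\gcd(v,w)^2}\Big\},$$ and $\Psi(Q)=\sum_{1\le q\le Q}\frac{2\psi(q)\phi(q)}{q}$, where $\phi$ is Euler's totient function. Let $0<\epsilon\le 4/5$, $\kappa>0$ and $C\ge 1$. Then there is a constant $M>0$, depending only on $\epsilon,\kappa,C$, such that for every $\psi:\mathbb N\to\mathbb R_{\ge 0}$, all real $y,t\ge 1$ and every integer $Q\ge 0$, $$\mathop{\sum\sum}_{\substack{(q,r)\in[1,Q]^2\\ D_{\psi,\psi}(q,r)\le y,\ \omega_t(q,r)\ge\kappa\log t}}\frac{\psi(q)\phi(q)}{q}\cdot\frac{\psi(r)\phi(r)}{r}\ \le\ M\,t^{-C}\,y^{1-\epsilon}\,\Psi(Q)^{1+\epsilon},$$ the sum being over pairs of integers $q,r\in\{1,\dots,Q\}$. -/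

import Mathlib

open scoped NNReal

noncomputable section

/-- `ω_t(v, w)`: the number of primes `p ≤ t` dividing `v * w / gcd (v, w) ^ 2`
(the division of natural numbers is exact). -/
def omegaT (t : ℝ) (v w : ℕ) : ℕ :=
  ((Finset.Icc 1 ⌊t⌋₊).filter (fun p => p.Prime ∧ p ∣ v * w / Nat.gcd v w ^ 2)).card

/-- `D_{ψ,θ}(v, w) = max (w ψ(v), v θ(w)) / gcd (v, w)`. -/
def bigD (ψ θ : ℕ → ℝ≥0) (v w : ℕ) : ℝ :=
  max ((w : ℝ) * (ψ v : ℝ)) ((v : ℝ) * (θ w : ℝ)) / (Nat.gcd v w : ℝ)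

/-- `Ψ(Q) = ∑_{1 ≤ q ≤ Q} 2 ψ(q) φ(q) / q`. -/
def bigPsi (ψ : ℕ → ℝ≥0) (Q : ℕ) : ℝ :=
  ∑ q ∈ Finset.Icc 1 Q, 2 * (ψ q : ℝ) * (Nat.totient q : ℝ) / (q : ℝ)

/-- The pairs `(q, r) ∈ [1, Q]²` with `D_{ψ,ψ}(q, r) ≤ y` and `ω_t(q, r) ≥ κ log t`. -/
def anatomyPairs (ψ : ℕ → ℝ≥0) (κ y t : ℝ) (Q : ℕ) : Finset (ℕ × ℕ) :=
  (Finset.Icc 1 Q ×ˢ Finset.Icc 1 Q).filter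
    (fun x => bigD ψ ψ x.1 x.2 ≤ y ∧ κ * Real.log t ≤ (omegaT t x.1 x.2 : ℝ))

end

open Finset

noncomputable section

/-! Put `f v = ψ v / (v * y)` on `[1, Q]`. Since `lcm * gcd` is the product, `D ≤ y` gives `lcm(v,
w) * max (f v, f w) ≤ 1`, the relation `IsEdge`, and in the measure `f v * φ(v)` the total mass is
`Ψ(Q) / (2y)`. With `s = (1 + ε) / 2`, which lies strictly between `1/2` and `1`, everything follows
from a bilinear bound: the sum over edges is at most a constant times `mass ^ s * mass ^ s`. The
condition on `ω_t` enters by Rankin's trick: each pair is weighted by `A` to the number of primes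
where the valuations differ, which must cost only a small power of `t`
(`exists_edgeBound_weighted`).

The bound is proved prime by prime. Splitting `v = p^i v'`, `w = p^j w'` reduces it to the integers
prime to `p`, with a kernel equal to `1` on the diagonal and at most `p^(-(1-s)|i-j|)` off it
(`edgeSum_prime_pow_mul_le`). For probability vectors the kernel sum is at most `1 + C/p`
(`exists_kerSum_le`). This loss is affordable at the primes up to `t`, where reciprocals sum to
`o(log t)`, but not at all primes.

At the remaining large primes no loss is allowed (`exists_edgeBound_rough`). If the kernel sum at
some prime is at most `1`, induction concludes. Otherwise, at every prime,
`exists_concentration_of_one_lt_kerSum` gives a dominant valuation `k_p`: edges with different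
valuations contribute a proportion `O(1/p)`, and edges with neither valuation equal to `k_p` a
proportion `O(p^(-2s))`. Put `N = ∏ p^(k_p)`. As `∑ p^(-2s)` and `∑ p^(-2)` have small tails, a
union bound and Markov's inequality dispose of at most half the target bound. The other edges are
near pairs: at each prime one end agrees with `N`, and the disagreements have `∑ 1/p ≤ 1`. Then
`φ(v)/v` is at most a constant times `φ(N)/N` and the lcm is at least `N` times the deviations of
`v` and `w` from `N`, so a dyadic argument applies directly (`sum_relation_le`,
`edgeSum_nearPair_le`). -/

/-! ### Schur's test and the kernel `q ^ |i - j|` -/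

/-- Schur's test for the exponents `s`. -/
theorem schur_rpow {s r X Y : ℝ} (hs : 1 / 2 ≤ s) (hX : 0 ≤ X) (hY : 0 ≤ Y) (hr : 0 ≤ r)
    {I J : Finset ℕ} {x y : ℕ → ℝ} {b : ℕ → ℕ → ℝ}
    (hx : ∀ i ∈ I, 0 ≤ x i) (hy : ∀ j ∈ J, 0 ≤ y j)
    (hxX : ∑ i ∈ I, x i ≤ X) (hyY : ∑ j ∈ J, y j ≤ Y)
    (hb : ∀ i ∈ I, ∀ j ∈ J, 0 ≤ b i j)
    (hrow : ∀ i ∈ I, ∑ j ∈ J, b i j ≤ r) (hcol : ∀ j ∈ J, ∑ i ∈ I, b i j ≤ r) :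
    ∑ i ∈ I, ∑ j ∈ J, b i j * (x i ^ s * y j ^ s) ≤ r * (X ^ s * Y ^ s) := by
  have hs0 : s ≠ 0 := by linarith
  have hxle : ∀ i ∈ I, x i ≤ X := fun i hi => (single_le_sum hx hi).trans hxX
  have hyle : ∀ j ∈ J, y j ≤ Y := fun j hj => (single_le_sum hy hj).trans hyY
  rcases hX.eq_or_lt with rfl | hX
  · have : ∀ i ∈ I, x i = 0 := fun i hi => le_antisymm (hxle i hi) (hx i hi)
    rw [sum_eq_zero (fun i hi => sum_eq_zero (fun j _ => by
      rw [this i hi, Real.zero_rpow hs0]; ring)), Real.zero_rpow hs0]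
    simp
  rcases hY.eq_or_lt with rfl | hY
  · have : ∀ j ∈ J, y j = 0 := fun j hj => le_antisymm (hyle j hj) (hy j hj)
    rw [sum_eq_zero (fun i _ => sum_eq_zero (fun j hj => by
      rw [this j hj, Real.zero_rpow hs0]; ring)), Real.zero_rpow hs0]
    simp
  -- As `2s ≥ 1` and `a / A ≤ 1`, raising `a / A` to the power `2s` only decreases it. After AM-GM
  -- this leaves linear weights, to which row and column sums apply.
  have key : ∀ a A : ℝ, 0 ≤ a → 0 < A → a ≤ A → (a ^ s) ^ 2 ≤ (A ^ s) ^ 2 * (a / A) := by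
    intro a A ha hA haA
    have h1 : a ^ s = A ^ s * (a / A) ^ s := by
      rw [Real.div_rpow ha hA.le]; field_simp
    have h2 : ((a / A) ^ s) ^ 2 ≤ a / A := by
      rw [← Real.rpow_natCast, ← Real.rpow_mul (by positivity)]
      calc (a / A) ^ (s * (2 : ℕ)) ≤ (a / A) ^ (1 : ℝ) :=
            Real.rpow_le_rpow_of_exponent_ge' (by positivity) ((div_le_one hA).2 haA)
              (by norm_num) (by push_cast; linarith)
        _ = a / A := Real.rpow_one _
    rw [h1, mul_pow]
    gcongr
  have hpt : ∀ i ∈ I, ∀ j ∈ J, b i j * (x i ^ s * y j ^ s)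
      ≤ (X ^ s * Y ^ s) / 2 * (x i / X * b i j) + (X ^ s * Y ^ s) / 2 * (y j / Y * b i j) := by
    intro i hi j hj
    have h1 := key _ _ (hx i hi) hX (hxle i hi)
    have h2 := key _ _ (hy j hj) hY (hyle j hj)
    have hXs : 0 < X ^ s := Real.rpow_pos_of_pos hX _
    have hYs : 0 < Y ^ s := Real.rpow_pos_of_pos hY _
    have h3 : x i ^ s * y j ^ s ≤ (X ^ s * Y ^ s) / 2 * (x i / X + y j / Y) := by
      have e1 : (x i ^ s / X ^ s) ^ 2 ≤ x i / X := by
        rw [div_pow, div_le_iff₀ (by positivity)]; linarith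
      have e2 : (y j ^ s / Y ^ s) ^ 2 ≤ y j / Y := by
        rw [div_pow, div_le_iff₀ (by positivity)]; linarith
      have e3 : x i ^ s * y j ^ s = (X ^ s * Y ^ s) * ((x i ^ s / X ^ s) * (y j ^ s / Y ^ s)) := by
        field_simp
      have e4 : (x i ^ s / X ^ s) * (y j ^ s / Y ^ s) ≤ (x i / X + y j / Y) / 2 := by
        nlinarith [sq_nonneg (x i ^ s / X ^ s - y j ^ s / Y ^ s)]
      calc _ = _ := e3
        _ ≤ (X ^ s * Y ^ s) * ((x i / X + y j / Y) / 2) := by gcongr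
        _ = _ := by ring
    calc _ ≤ b i j * ((X ^ s * Y ^ s) / 2 * (x i / X + y j / Y)) :=
          mul_le_mul_of_nonneg_left h3 (hb i hi j hj)
      _ = _ := by ring
  refine (sum_le_sum fun i hi => sum_le_sum fun j hj => hpt i hi j hj).trans ?_
  simp_rw [sum_add_distrib, ← mul_sum]
  have hc : 0 ≤ (X ^ s * Y ^ s) / 2 := by positivity
  have h1 : ∑ i ∈ I, x i / X * ∑ j ∈ J, b i j ≤ r := by
    calc _ ≤ ∑ i ∈ I, x i / X * r := sum_le_sum fun i hi =>
          mul_le_mul_of_nonneg_left (hrow i hi) (div_nonneg (hx i hi) hX.le)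
      _ = (∑ i ∈ I, x i) / X * r := by rw [sum_div, sum_mul]
      _ ≤ 1 * r := by gcongr; exact (div_le_one hX).2 hxX
      _ = r := one_mul r
  have h2 : ∑ i ∈ I, ∑ j ∈ J, y j / Y * b i j ≤ r := by
    rw [sum_comm]
    simp_rw [← mul_sum]
    calc _ ≤ ∑ j ∈ J, y j / Y * r := sum_le_sum fun i hi =>
          mul_le_mul_of_nonneg_left (hcol i hi) (div_nonneg (hy i hi) hY.le)
      _ = (∑ i ∈ J, y i) / Y * r := by rw [sum_div, sum_mul]
      _ ≤ 1 * r := by gcongr; exact (div_le_one hY).2 hyY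
      _ = r := one_mul r
  calc _ ≤ (X ^ s * Y ^ s) / 2 * r + (X ^ s * Y ^ s) / 2 * r := by gcongr
    _ = _ := by ring

theorem geom_sum_range_le {q : ℝ} (h0 : 0 ≤ q) (h1 : q < 1) (n : ℕ) :
    ∑ i ∈ range n, q ^ i ≤ 1 / (1 - q) := by
  have := (summable_geometric_of_lt_one h0 h1).sum_le_tsum (range n) (fun i _ => by positivity)
  rwa [tsum_geometric_of_lt_one h0 h1, ← one_div] at this

/-- The off-diagonal kernel `q ^ |i - j|`. -/
def offKer (q : ℝ) (i j : ℕ) : ℝ := if i = j then 0 else q ^ ((i - j) + (j - i))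

theorem offKer_nonneg {q : ℝ} (h0 : 0 ≤ q) (i j : ℕ) : 0 ≤ offKer q i j := by
  unfold offKer; split_ifs <;> positivity

theorem offKer_comm (q : ℝ) (i j : ℕ) : offKer q i j = offKer q j i := by
  unfold offKer; simp only [eq_comm, add_comm]

theorem sum_offKer_le {q : ℝ} (h0 : 0 ≤ q) (h1 : q < 1) (J : Finset ℕ) (i : ℕ) :
    ∑ j ∈ J, offKer q i j ≤ 2 * q / (1 - q) := by
  obtain ⟨n, hn⟩ : ∃ n, J ⊆ range n := J.exists_nat_subset_range
  have h1q : 0 < 1 - q := by linarith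
  calc ∑ j ∈ J, offKer q i j ≤ ∑ j ∈ range (i + 1 + n), offKer q i j :=
        sum_le_sum_of_subset_of_nonneg (hn.trans (range_subset_range.2 (by omega)))
          (fun _ _ _ => offKer_nonneg h0 _ _)
    _ = ∑ j ∈ range i, q * q ^ j + ∑ j ∈ range n, q * q ^ j := by
        rw [sum_range_add, sum_range_succ]
        congr 1
        · rw [← sum_range_reflect]
          simp only [offKer, if_true, add_zero]
          refine sum_congr rfl fun j hj => ?_
          have := mem_range.1 hj
          rw [if_neg (by omega), ← pow_succ']
          congr 1; omega
        · refine sum_congr rfl fun j _ => ?_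
          rw [offKer, if_neg (by omega), ← pow_succ']
          congr 1; omega
    _ ≤ q * (1 / (1 - q)) + q * (1 / (1 - q)) := by
        rw [← mul_sum, ← mul_sum]
        gcongr <;> exact geom_sum_range_le h0 h1 _
    _ = 2 * q / (1 - q) := by ring

/-- The kernel with `1` on the diagonal and `A * q ^ |i - j|` off it. -/
def ker (A q : ℝ) (i j : ℕ) : ℝ := (if i = j then 1 else 0) + A * offKer q i j

theorem sum_offKer_rpow_le {s q X Y : ℝ} (hs : 1 / 2 ≤ s) (hX : 0 ≤ X) (hY : 0 ≤ Y)
    (h0 : 0 ≤ q) (h1 : q ≤ 1 / 2)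
    {I J : Finset ℕ} {x y : ℕ → ℝ}
    (hx : ∀ i ∈ I, 0 ≤ x i) (hy : ∀ j ∈ J, 0 ≤ y j)
    (hxX : ∑ i ∈ I, x i ≤ X) (hyY : ∑ j ∈ J, y j ≤ Y) :
    ∑ i ∈ I, ∑ j ∈ J, offKer q i j * (x i ^ s * y j ^ s) ≤ 4 * q * (X ^ s * Y ^ s) := by
  have h : 2 * q / (1 - q) ≤ 4 * q := by
    rw [div_le_iff₀ (by linarith)]; nlinarith
  refine schur_rpow hs hX hY (by positivity) hx hy hxX hyY (fun i _ j _ => offKer_nonneg h0 i j)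
    (fun i _ => (sum_offKer_le h0 (by linarith) J i).trans h) (fun j _ => ?_)
  simp_rw [fun i => offKer_comm q i j]
  exact (sum_offKer_le h0 (by linarith) I j).trans h

theorem sum_diag_rpow_le {s X Y : ℝ} (hs : 1 / 2 ≤ s) (hX : 0 ≤ X) (hY : 0 ≤ Y)
    {I J : Finset ℕ} {x y : ℕ → ℝ}
    (hx : ∀ i ∈ I, 0 ≤ x i) (hy : ∀ j ∈ J, 0 ≤ y j)
    (hxX : ∑ i ∈ I, x i ≤ X) (hyY : ∑ j ∈ J, y j ≤ Y) :
    ∑ i ∈ I, ∑ j ∈ J, (if i = j then 1 else 0) * (x i ^ s * y j ^ s) ≤ X ^ s * Y ^ s := by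
  rw [← one_mul (X ^ s * Y ^ s)]
  refine schur_rpow hs hX hY zero_le_one hx hy hxX hyY (fun i _ j _ => by split_ifs <;> norm_num)
    (fun i _ => ?_) (fun j _ => ?_)
  · rw [sum_ite_eq]; split_ifs <;> norm_num
  · rw [sum_ite_eq']; split_ifs <;> norm_num

/-- The sum over `I × J` of the kernel. -/
def kerSum (A q s : ℝ) (I J : Finset ℕ) (x y : ℕ → ℝ) : ℝ :=
  ∑ i ∈ I, ∑ j ∈ J, ker A q i j * (x i ^ s * y j ^ s)

theorem kerSum_eq (A q s : ℝ) (I J : Finset ℕ) (x y : ℕ → ℝ) :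
    kerSum A q s I J x y = ∑ i ∈ I, ∑ j ∈ J, (if i = j then 1 else 0) * (x i ^ s * y j ^ s) +
      A * ∑ i ∈ I, ∑ j ∈ J, offKer q i j * (x i ^ s * y j ^ s) := by
  simp only [kerSum, ker, add_mul, sum_add_distrib, mul_sum, mul_assoc]

theorem offKer_self (q : ℝ) (i : ℕ) : offKer q i i = 0 := by simp [offKer]

set_option maxHeartbeats 2000000 in
/-- If the kernel sum of two probability vectors exceeds `1`, both are concentrated at a
common index. -/
theorem exists_concentration_of_one_lt_kerSum {s A : ℝ} (hs : 1 / 2 < s) (hs1 : s < 1)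
    (hA : 1 ≤ A) :
    ∃ P₁ C : ℝ, 1 ≤ P₁ ∧ 0 < C ∧ ∀ P : ℝ, P₁ ≤ P → ∀ (n : ℕ) (x y : ℕ → ℝ),
      (∀ i, 0 ≤ x i) → (∀ i, 0 ≤ y i) → ∑ i ∈ range n, x i = 1 → ∑ i ∈ range n, y i = 1 →
      1 < kerSum A (P ^ (-(1 - s))) s (range n) (range n) x y →
      ∃ k, A * ∑ i ∈ range n, ∑ j ∈ range n, offKer (P ^ (-(1 - s))) i j * (x i ^ s * y j ^ s)
          ≤ C / P ∧
        kerSum A (P ^ (-(1 - s))) s ((range n).erase k) ((range n).erase k) x y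
          ≤ C * P ^ (-(2 * s)) := by
  -- Below, `u` is the mass missing from the dominant index in both vectors; `u ≤ 2 * u₀` is exactly
  -- what gives `u ^ (2s - 1) ≤ 1/4`.
  set u₀ : ℝ := 1 / 2 * (1 / 4) ^ (1 / (2 * s - 1)) with hu₀
  have h2s : 0 < 2 * s - 1 := by linarith
  have hq4 : (1 / 4 : ℝ) ^ (1 / (2 * s - 1)) ≤ 1 :=
    Real.rpow_le_one (by norm_num) (by norm_num) (by positivity)
  have hu₀pos : 0 < u₀ := by positivity
  have hu₀le : u₀ ≤ 1 / 2 := by rw [hu₀]; linarith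
  have hm1 : (1 - u₀) ^ (s - 1 / 2) < 1 :=
    Real.rpow_lt_one (by linarith) (by linarith) (by linarith)
  set q₀ : ℝ := min (1 / 2) ((1 - (1 - u₀) ^ (s - 1 / 2)) / (4 * A)) with hq₀
  have hq₀pos : 0 < q₀ := lt_min (by norm_num) (div_pos (by linarith) (by linarith))
  obtain ⟨P₀, hP₀⟩ : ∃ P₀, ∀ P ≥ P₀, P ^ (-(1 - s)) < q₀ := by
    have := (tendsto_rpow_neg_atTop (y := 1 - s) (by linarith)).eventually (gt_mem_nhds hq₀pos)
    exact Filter.eventually_atTop.1 this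
  set C₁ : ℝ := (48 * A) ^ (1 / (1 - s)) with hC₁
  have hC₁pos : 0 < C₁ := by positivity
  refine ⟨max 1 P₀, 12 * A * C₁ ^ s + (1 + 4 * A) * C₁ ^ (2 * s), le_max_left _ _,
    by positivity, ?_⟩
  intro P hP n x y hx hy hx1 hy1 hT
  have hP1 : 1 ≤ P := (le_max_left _ _).trans hP
  have hP0 : 0 < P := by linarith
  have hq := hP₀ P ((le_max_right _ _).trans hP)
  set q := P ^ (-(1 - s)) with hqdef
  have hq0 : 0 < q := by positivity
  have hqhalf : q ≤ 1 / 2 := hq.le.trans (min_le_left _ _)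
  have hqA : 4 * A * q ≤ 1 - (1 - u₀) ^ (s - 1 / 2) := by
    have := hq.le.trans (min_le_right _ _)
    rw [le_div_iff₀ (by positivity)] at this; linarith
  have hne : (range n).Nonempty := by
    rw [nonempty_iff_ne_empty]; intro h; rw [h] at hx1; simp at hx1
  obtain ⟨k, hk, hmax⟩ := exists_max_image (range n) (fun i => x i * y i) hne
  have hs' : 1 / 2 ≤ s := hs.le
  have hxk1 : x k ≤ 1 := hx1 ▸ single_le_sum (fun i _ => hx i) hk
  have hyk1 : y k ≤ 1 := hy1 ▸ single_le_sum (fun i _ => hy i) hk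
  have hO := sum_offKer_rpow_le hs' zero_le_one zero_le_one hq0.le hqhalf
    (fun i _ => hx i) (fun i _ => hy i) hx1.le hy1.le
  simp only [Real.one_rpow, mul_one] at hO
  -- Each diagonal term is `(x i * y i) ^ (s - 1/2)` times a geometric mean; the first factor is
  -- largest at `k` and the means sum to at most `1`.
  have hD : ∑ i ∈ range n, ∑ j ∈ range n, (if i = j then 1 else 0) * (x i ^ s * y j ^ s)
      ≤ (x k * y k) ^ (s - 1 / 2) := by
    calc _ = ∑ i ∈ range n, x i ^ s * y i ^ s := by
          refine sum_congr rfl fun i hi => ?_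
          simp [ite_mul, hi]
      _ ≤ ∑ i ∈ range n, (x k * y k) ^ (s - 1 / 2) * ((x i + y i) / 2) := by
          refine sum_le_sum fun i hi => ?_
          have hxy : 0 ≤ x i * y i := mul_nonneg (hx i) (hy i)
          rw [← Real.mul_rpow (hx i) (hy i)]
          have h1 : (x i * y i) ^ s = (x i * y i) ^ (s - 1 / 2) * (x i * y i) ^ (1 / 2 : ℝ) := by
            rw [← Real.rpow_add' hxy (by linarith)]; congr 1; ring
          rw [h1]
          have h2 : (x i * y i) ^ (s - 1 / 2) ≤ (x k * y k) ^ (s - 1 / 2) :=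
            Real.rpow_le_rpow hxy (hmax i hi) (by linarith)
          have h3 : (x i * y i) ^ (1 / 2 : ℝ) ≤ (x i + y i) / 2 := by
            rw [← Real.sqrt_eq_rpow]
            refine Real.sqrt_le_iff.2 ⟨by have := hx i; have := hy i; positivity, ?_⟩
            nlinarith [sq_nonneg (x i - y i)]
          exact mul_le_mul h2 h3 (by positivity) (Real.rpow_nonneg (mul_nonneg (hx k) (hy k)) _)
      _ = (x k * y k) ^ (s - 1 / 2) := by
          rw [← mul_sum, ← sum_div, sum_add_distrib, hx1, hy1]; norm_num
  -- The off-diagonal part is at most `4Aq`, and `q₀` was chosen so that it cannot make up for a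
  -- diagonal part with `x k * y k ≤ 1 - u₀`.
  have hxyk : 1 - u₀ < x k * y k := by
    by_contra! h
    have h1 : (x k * y k) ^ (s - 1 / 2) ≤ (1 - u₀) ^ (s - 1 / 2) :=
      Real.rpow_le_rpow (mul_nonneg (hx k) (hy k)) h (by linarith)
    rw [kerSum_eq] at hT
    have h2 := mul_le_mul_of_nonneg_left hO (by linarith : 0 ≤ A)
    linarith
  have hxk : 1 - u₀ < x k := hxyk.trans_le (mul_le_of_le_one_right (hx k) hyk1)
  have hyk : 1 - u₀ < y k := hxyk.trans_le (mul_le_of_le_one_left (hy k) hxk1)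
  set J := (range n).erase k with hJ
  have hsum : ∀ F : ℕ → ℝ, ∑ i ∈ range n, F i = F k + ∑ i ∈ J, F i := fun F =>
    (add_sum_erase _ _ hk).symm
  set a := 1 - x k with ha
  set b := 1 - y k with hb
  have ha0 : 0 ≤ a := by linarith
  have hb0 : 0 ≤ b := by linarith
  have hJa : ∑ i ∈ J, x i ≤ a := by rw [hsum] at hx1; linarith
  have hJb : ∑ i ∈ J, y i ≤ b := by rw [hsum] at hy1; linarith
  set u := a + b with hu
  have hu0 : 0 ≤ u := by positivity
  have huu : u ≤ (1 / 4) ^ (1 / (2 * s - 1)) := by linarith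
  have hu1 : u ≤ 1 := huu.trans hq4
  have hus0 : 0 ≤ u ^ s := Real.rpow_nonneg hu0 _
  have hus1 : u ^ s ≤ 1 := Real.rpow_le_one hu0 hu1 (by linarith)
  have hasu : a ^ s ≤ u ^ s := Real.rpow_le_rpow ha0 (by linarith) (by linarith)
  have hbsu : b ^ s ≤ u ^ s := Real.rpow_le_rpow hb0 (by linarith) (by linarith)
  have has0 : 0 ≤ a ^ s := Real.rpow_nonneg ha0 _
  have hbs0 : 0 ≤ b ^ s := Real.rpow_nonneg hb0 _
  have hab : a ^ s * b ^ s ≤ u ^ s * u ^ s := mul_le_mul hasu hbsu hbs0 hus0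
  have hu2s : u ^ s * u ^ s = u ^ (2 * s) := by
    rw [← Real.rpow_add' hu0 (by linarith)]; congr 1; ring
  have hu4 : u ^ (2 * s) ≤ u / 4 := by
    have h1 : u ^ (2 * s) = u * u ^ (2 * s - 1) := by
      rw [← Real.rpow_one_add' hu0 (by linarith)]; congr 1; ring
    have h2 : u ^ (2 * s - 1) ≤ 1 / 4 := by
      calc u ^ (2 * s - 1) ≤ ((1 / 4 : ℝ) ^ (1 / (2 * s - 1))) ^ (2 * s - 1) :=
            Real.rpow_le_rpow hu0 huu h2s.le
        _ = 1 / 4 := by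
            rw [← Real.rpow_mul (by norm_num), one_div_mul_cancel h2s.ne', Real.rpow_one]
    rw [h1]; nlinarith
  have hkk : x k ^ s * y k ^ s ≤ 1 - u / 2 := by
    rw [← Real.mul_rpow (hx k) (hy k)]
    have h1 : x k * y k ≤ (1 - u / 2) ^ (2 : ℝ) := by
      rw [Real.rpow_two]; nlinarith [sq_nonneg (a - b)]
    calc (x k * y k) ^ s ≤ ((1 - u / 2) ^ (2 : ℝ)) ^ s :=
          Real.rpow_le_rpow (mul_nonneg (hx k) (hy k)) h1 (by linarith)
      _ = (1 - u / 2) ^ (2 * s) := by rw [← Real.rpow_mul (by linarith)]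
      _ ≤ (1 - u / 2) ^ (1 : ℝ) :=
          Real.rpow_le_rpow_of_exponent_ge' (by linarith) (by linarith) (by norm_num) (by linarith)
      _ = 1 - u / 2 := Real.rpow_one _
  have hkJ : ∑ j ∈ J, offKer q k j * (x k ^ s * y j ^ s) ≤ 4 * q * u ^ s := by
    have := sum_offKer_rpow_le (I := {k}) (J := J) (x := x) (y := y) hs' zero_le_one hb0 hq0.le
      hqhalf (fun i _ => hx i) (fun i _ => hy i) (by simpa using hxk1) hJb
    rw [sum_singleton, Real.one_rpow, one_mul] at this
    exact this.trans (by gcongr)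
  have hJk : ∑ i ∈ J, offKer q i k * (x i ^ s * y k ^ s) ≤ 4 * q * u ^ s := by
    have := sum_offKer_rpow_le (I := J) (J := {k}) (x := x) (y := y) hs' ha0 zero_le_one hq0.le
      hqhalf (fun i _ => hx i) (fun i _ => hy i) hJa (by simpa using hyk1)
    simp only [sum_singleton, Real.one_rpow, mul_one] at this
    exact this.trans (by gcongr)
  have hJJ : ∑ i ∈ J, ∑ j ∈ J, offKer q i j * (x i ^ s * y j ^ s) ≤ 4 * q * (u ^ s * u ^ s) :=
    (sum_offKer_rpow_le hs' ha0 hb0 hq0.le hqhalf (fun i _ => hx i) (fun i _ => hy i)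
      hJa hJb).trans (by gcongr)
  have hJD : ∑ i ∈ J, ∑ j ∈ J, (if i = j then 1 else 0) * (x i ^ s * y j ^ s) ≤ u ^ s * u ^ s :=
    (sum_diag_rpow_le hs' ha0 hb0 (fun i _ => hx i) (fun i _ => hy i) hJa hJb).trans hab
  have hOall : ∑ i ∈ range n, ∑ j ∈ range n, offKer q i j * (x i ^ s * y j ^ s)
      ≤ 12 * q * u ^ s := by
    have e : ∑ i ∈ range n, ∑ j ∈ range n, offKer q i j * (x i ^ s * y j ^ s) =
        ∑ j ∈ J, offKer q k j * (x k ^ s * y j ^ s) + (∑ i ∈ J, offKer q i k * (x i ^ s * y k ^ s)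
        + ∑ i ∈ J, ∑ j ∈ J, offKer q i j * (x i ^ s * y j ^ s)) := by
      simp_rw [hsum, sum_add_distrib, offKer_self]; ring
    have : 4 * q * (u ^ s * u ^ s) ≤ 4 * q * (u ^ s * 1) := by gcongr
    rw [e]; linarith
  have hDall : ∑ i ∈ range n, ∑ j ∈ range n, (if i = j then 1 else 0) * (x i ^ s * y j ^ s)
      ≤ (1 - u / 2) + u / 4 := by
    have e : ∑ i ∈ range n, ∑ j ∈ range n, (if i = j then 1 else 0) * (x i ^ s * y j ^ s) =
        x k ^ s * y k ^ s
        + ∑ i ∈ J, ∑ j ∈ J, (if i = j then 1 else 0) * (x i ^ s * y j ^ s) := by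
      simp_rw [hsum, sum_add_distrib]
      have h1 : ∑ j ∈ J, (if k = j then (1 : ℝ) else 0) * (x k ^ s * y j ^ s) = 0 :=
        sum_eq_zero fun j hj => by rw [if_neg (ne_of_mem_erase hj).symm, zero_mul]
      have h2 : ∑ j ∈ J, (if j = k then (1 : ℝ) else 0) * (x j ^ s * y k ^ s) = 0 :=
        sum_eq_zero fun j hj => by rw [if_neg (ne_of_mem_erase hj), zero_mul]
      rw [h1, h2]; simp
    rw [e]; linarith
  -- The diagonal loses at least `u/4` while the off-diagonal part gains at most `12 A q u^s`; a
  -- total above `1` forces the gain to exceed the loss. Since `s < 1` this bounds `u` by a multiple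
  -- of `q^(1/(1-s)) = 1/P`.
  have hmain : u < 48 * A * q * u ^ s := by
    rw [kerSum_eq] at hT
    have := mul_le_mul_of_nonneg_left hOall (by linarith : 0 ≤ A)
    linarith
  have hupos : 0 < u := by
    rcases hu0.eq_or_lt with h | h
    · rw [← h, Real.zero_rpow (by linarith)] at hmain; simp at hmain
    · exact h
  have huC : u ≤ C₁ * P⁻¹ := by
    have h1 : u ^ (1 - s) ≤ 48 * A * q := by
      rw [Real.rpow_sub hupos, Real.rpow_one, div_le_iff₀ (by positivity)]; exact hmain.le
    calc u = (u ^ (1 - s)) ^ (1 / (1 - s)) := by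
          rw [← Real.rpow_mul hu0, mul_one_div_cancel (by linarith), Real.rpow_one]
      _ ≤ (48 * A * q) ^ (1 / (1 - s)) :=
          Real.rpow_le_rpow (by positivity) h1 (by have : 0 < 1 - s := by linarith
                                                   positivity)
      _ = C₁ * P⁻¹ := by
          rw [Real.mul_rpow (by positivity) hq0.le, hqdef, ← Real.rpow_mul hP0.le, ← hC₁,
            neg_mul, mul_one_div_cancel (by linarith), Real.rpow_neg_one]
  have hus : u ^ s ≤ C₁ ^ s * P ^ (-s) := by
    rw [Real.rpow_neg hP0.le, ← Real.inv_rpow hP0.le, ← Real.mul_rpow hC₁pos.le (by positivity)]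
    exact Real.rpow_le_rpow hu0 huC (by linarith)
  have hu2 : u ^ (2 * s) ≤ C₁ ^ (2 * s) * P ^ (-(2 * s)) := by
    rw [Real.rpow_neg hP0.le, ← Real.inv_rpow hP0.le, ← Real.mul_rpow hC₁pos.le (by positivity)]
    exact Real.rpow_le_rpow hu0 huC (by linarith)
  refine ⟨k, ?_, ?_⟩
  · calc _ ≤ A * (12 * q * (C₁ ^ s * P ^ (-s))) := by
          gcongr; exact hOall.trans (by gcongr)
      _ = 12 * A * C₁ ^ s * (P ^ (-(1 - s)) * P ^ (-s)) := by rw [hqdef]; ring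
      _ = 12 * A * C₁ ^ s / P := by
          rw [← Real.rpow_add hP0, show -(1 - s) + -s = -1 by ring, Real.rpow_neg_one]; rfl
      _ ≤ _ := by gcongr; exact le_add_of_nonneg_right (by positivity)
  · rw [kerSum_eq]
    have h1 := mul_le_mul_of_nonneg_left hJJ (by linarith : 0 ≤ A)
    rw [hu2s] at h1 hJD
    calc _ ≤ u ^ (2 * s) + A * (4 * q * u ^ (2 * s)) := add_le_add hJD h1
      _ = (1 + 4 * A * q) * u ^ (2 * s) := by ring
      _ ≤ (1 + 4 * A) * (C₁ ^ (2 * s) * P ^ (-(2 * s))) := by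
          refine mul_le_mul ?_ hu2 (by positivity) (by positivity)
          nlinarith
      _ = (1 + 4 * A) * C₁ ^ (2 * s) * P ^ (-(2 * s)) := by ring
      _ ≤ _ := by gcongr; exact le_add_of_nonneg_left (by positivity)

/-- The kernel sum of two probability vectors exceeds `1` by `O (1 / p)` at most. -/
theorem exists_kerSum_le {s A : ℝ} (hs : 1 / 2 < s) (hs1 : s < 1) (hA : 1 ≤ A) :
    ∃ C : ℝ, 0 < C ∧ ∀ P : ℝ, 2 ≤ P → ∀ (n : ℕ) (x y : ℕ → ℝ),
      (∀ i, 0 ≤ x i) → (∀ i, 0 ≤ y i) → ∑ i ∈ range n, x i = 1 → ∑ i ∈ range n, y i = 1 →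
      kerSum A (P ^ (-(1 - s))) s (range n) (range n) x y ≤ 1 + C / P := by
  obtain ⟨P₁, C, hP₁, hC, h⟩ := exists_concentration_of_one_lt_kerSum hs hs1 hA
  set q₂ : ℝ := 2 ^ (-(1 - s)) with hq₂
  have hq₂pos : 0 < q₂ := by positivity
  have hq₂1 : q₂ < 1 := Real.rpow_lt_one_of_one_lt_of_neg (by norm_num) (by linarith)
  have hR : 0 ≤ A * (2 * q₂ / (1 - q₂)) := by
    have : 0 < 1 - q₂ := by linarith
    positivity
  -- The second term serves the range `2 ≤ P < P₁`, where Schur's test with `q ≤ q₂` bounds the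
  -- excess by a constant and `P₁ / P > 1`.
  refine ⟨C + A * (2 * q₂ / (1 - q₂)) * P₁, by positivity, ?_⟩
  intro P hP n x y hx hy hx1 hy1
  have hP0 : 0 < P := by linarith
  have hD : ∑ i ∈ range n, ∑ j ∈ range n, (if i = j then 1 else 0) * (x i ^ s * y j ^ s) ≤ 1 := by
    simpa using sum_diag_rpow_le hs.le zero_le_one zero_le_one
      (fun i _ => hx i) (fun i _ => hy i) hx1.le hy1.le
  by_cases hPP : P₁ ≤ P
  · by_cases hT : 1 < kerSum A (P ^ (-(1 - s))) s (range n) (range n) x y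
    · obtain ⟨k, hk, -⟩ := h P hPP n x y hx hy hx1 hy1 hT
      rw [kerSum_eq]
      have : C / P ≤ (C + A * (2 * q₂ / (1 - q₂)) * P₁) / P := by
        gcongr; exact le_add_of_nonneg_right (by positivity)
      linarith
    · have : 0 ≤ (C + A * (2 * q₂ / (1 - q₂)) * P₁) / P := by positivity
      linarith
  · push Not at hPP
    set q := P ^ (-(1 - s)) with hq
    have hq0 : 0 < q := by positivity
    have hqq : q ≤ q₂ := Real.rpow_le_rpow_of_nonpos (by norm_num) hP (by linarith)
    have hr : 2 * q / (1 - q) ≤ 2 * q₂ / (1 - q₂) := by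
      have : 0 < 1 - q₂ := by linarith
      gcongr
    have hO : ∑ i ∈ range n, ∑ j ∈ range n, offKer q i j * (x i ^ s * y j ^ s)
        ≤ 2 * q₂ / (1 - q₂) := by
      have : ∑ i ∈ range n, ∑ j ∈ range n, offKer q i j * (x i ^ s * y j ^ s)
          ≤ 2 * q₂ / (1 - q₂) * (1 ^ s * 1 ^ s) := by
        refine schur_rpow hs.le zero_le_one zero_le_one ?_ (fun i _ => hx i) (fun i _ => hy i)
          hx1.le hy1.le (fun i _ j _ => offKer_nonneg hq0.le i j)
          (fun i _ => (sum_offKer_le hq0.le (by linarith) _ i).trans hr) (fun j _ => ?_)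
        · have : 0 < 1 - q₂ := by linarith
          positivity
        · simp_rw [fun i => offKer_comm q i j]
          exact (sum_offKer_le hq0.le (by linarith) _ j).trans hr
      simpa using this
    rw [kerSum_eq]
    have h1 := mul_le_mul_of_nonneg_left hO (by linarith : 0 ≤ A)
    have h2 : A * (2 * q₂ / (1 - q₂)) ≤ (C + A * (2 * q₂ / (1 - q₂)) * P₁) / P := by
      rw [le_div_iff₀ hP0]
      have := mul_le_mul_of_nonneg_left hPP.le hR
      linarith
    linarith

/-! ### Edge sums and the splitting off of one prime -/

theorem sum_divisors_prime_pow_mul {p m e : ℕ} (hp : p.Prime) (hpm : ¬ p ∣ m) (F : ℕ → ℝ) :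
    ∑ v ∈ (p ^ e * m).divisors, F v = ∑ i ∈ range (e + 1), ∑ v ∈ m.divisors, F (p ^ i * v) := by
  have hm : m ≠ 0 := fun h => hpm (h ▸ dvd_zero p)
  rw [← sum_product' (range (e + 1)) m.divisors (fun i v => F (p ^ i * v))]
  symm
  refine sum_nbij' (fun x => p ^ x.1 * x.2) (fun v => (v.factorization p, ordCompl[p] v))
    ?_ ?_ ?_ ?_ ?_
  · rintro ⟨i, v⟩ h
    simp only [mem_product, mem_range, Nat.mem_divisors] at h ⊢
    exact ⟨mul_dvd_mul (pow_dvd_pow p (by omega)) h.2.1, by have := hp.ne_zero; positivity⟩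
  · intro v h
    simp only [mem_product, mem_range, Nat.mem_divisors] at h ⊢
    have hv0 : v ≠ 0 := ne_zero_of_dvd_ne_zero h.2 h.1
    refine ⟨?_, ?_, hm⟩
    · have := (Nat.factorization_le_iff_dvd hv0 h.2).2 h.1 p
      rw [Nat.factorization_mul (pow_ne_zero _ hp.ne_zero) hm, hp.factorization_pow] at this
      simp [Nat.factorization_eq_zero_of_not_dvd hpm] at this
      omega
    · have hco : (ordCompl[p] v).Coprime (p ^ e) :=
        (Nat.coprime_ordCompl hp hv0).symm.pow_right e
      exact hco.dvd_of_dvd_mul_left ((Nat.ordCompl_dvd v p).trans h.1)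
  · rintro ⟨i, v⟩ h
    simp only [mem_product, mem_range, Nat.mem_divisors] at h
    have hv0 : v ≠ 0 := ne_zero_of_dvd_ne_zero h.2.2 h.2.1
    have hpv : ¬ p ∣ v := fun h' => hpm (h'.trans h.2.1)
    have : (p ^ i * v).factorization p = i := by
      rw [Nat.factorization_mul (pow_ne_zero _ hp.ne_zero) hv0, hp.factorization_pow]
      simp [Nat.factorization_eq_zero_of_not_dvd hpv]
    simp only [this, Prod.mk.injEq, true_and]
    exact Nat.mul_div_cancel_left _ (pow_pos hp.pos i)
  · intro v _
    exact Nat.ordProj_mul_ordCompl_eq_self v p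
  · intro x _; rfl

/-- The mass `∑ f(v) φ(v)` over the divisors of `H`. -/
def mass (H : ℕ) (f : ℕ → ℝ) : ℝ := ∑ v ∈ H.divisors, f v * Nat.totient v

/-- The relation `lcm(v, w) * max (f v, g w) ≤ 1`. -/
def IsEdge (f g : ℕ → ℝ) (v w : ℕ) : Prop :=
  (Nat.lcm v w : ℝ) * f v ≤ 1 ∧ (Nat.lcm v w : ℝ) * g w ≤ 1

open Classical in
/-- The sum of `h(v, w) f(v) φ(v) g(w) φ(w)` over the edges between divisors of `H`. -/
def edgeSum (h : ℕ → ℕ → ℝ) (H : ℕ) (f g : ℕ → ℝ) : ℝ :=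
  ∑ v ∈ H.divisors, ∑ w ∈ H.divisors,
    if IsEdge f g v w then h v w * ((f v * Nat.totient v) * (g w * Nat.totient w)) else 0

/-- The estimate `edgeSum h H f g ≤ B (mass H f * mass H g) ^ s` for all nonnegative `f, g`. -/
def EdgeBound (h : ℕ → ℕ → ℝ) (H : ℕ) (s B : ℝ) : Prop :=
  ∀ f g : ℕ → ℝ, (∀ v, 0 ≤ f v) → (∀ w, 0 ≤ g w) →
    edgeSum h H f g ≤ B * (mass H f ^ s * mass H g ^ s)

theorem mass_nonneg {H : ℕ} {f : ℕ → ℝ} (hf : ∀ v, 0 ≤ f v) : 0 ≤ mass H f :=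
  sum_nonneg fun v _ => mul_nonneg (hf v) (Nat.cast_nonneg _)

theorem edgeSum_mono {h h' : ℕ → ℕ → ℝ} {H : ℕ} {f g : ℕ → ℝ} (hf : ∀ v, 0 ≤ f v)
    (hg : ∀ w, 0 ≤ g w) (hh : ∀ v ∈ H.divisors, ∀ w ∈ H.divisors, h v w ≤ h' v w) :
    edgeSum h H f g ≤ edgeSum h' H f g := by
  refine sum_le_sum fun v hv => sum_le_sum fun w hw => ?_
  split_ifs
  · exact mul_le_mul_of_nonneg_right (hh v hv w hw)
      (mul_nonneg (mul_nonneg (hf v) (Nat.cast_nonneg _)) (mul_nonneg (hg w) (Nat.cast_nonneg _)))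
  · exact le_rfl

theorem edgeSum_add (h h' : ℕ → ℕ → ℝ) (H : ℕ) (f g : ℕ → ℝ) :
    edgeSum (fun v w => h v w + h' v w) H f g = edgeSum h H f g + edgeSum h' H f g := by
  simp only [edgeSum, ← sum_add_distrib]
  refine sum_congr rfl fun v _ => sum_congr rfl fun w _ => ?_
  split_ifs <;> ring

theorem edgeSum_mul (c : ℝ) (h : ℕ → ℕ → ℝ) (H : ℕ) (f g : ℕ → ℝ) :
    edgeSum (fun v w => c * h v w) H f g = c * edgeSum h H f g := by
  simp only [edgeSum, mul_sum]
  refine sum_congr rfl fun v _ => sum_congr rfl fun w _ => ?_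
  split_ifs <;> ring

theorem edgeSum_sum {ι : Type*} (S : Finset ι) (h : ι → ℕ → ℕ → ℝ) (H : ℕ) (f g : ℕ → ℝ) :
    edgeSum (fun v w => ∑ i ∈ S, h i v w) H f g = ∑ i ∈ S, edgeSum (h i) H f g := by
  classical
  induction S using Finset.induction_on with
  | empty => simp [edgeSum]
  | insert a S ha ih =>
    simp only [sum_insert ha]
    rw [edgeSum_add, ih]

theorem lcm_prime_pow_mul {p i j v w : ℕ} (hp : p.Prime) (hv : ¬ p ∣ v) (hw : ¬ p ∣ w) :
    Nat.lcm (p ^ i * v) (p ^ j * w) = p ^ max i j * Nat.lcm v w := by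
  have hvc : ∀ k, (p ^ k).Coprime v := fun k => ((Nat.Prime.coprime_iff_not_dvd hp).2 hv).pow_left k
  have hwc : ∀ k, (p ^ k).Coprime w := fun k => ((Nat.Prime.coprime_iff_not_dvd hp).2 hw).pow_left k
  have hl : ∀ k, (p ^ k).Coprime (Nat.lcm v w) := fun k =>
    Nat.Coprime.of_dvd_right (Nat.lcm_dvd_mul v w) ((hvc k).mul_right (hwc k))
  apply Nat.dvd_antisymm
  · exact Nat.lcm_dvd (mul_dvd_mul (pow_dvd_pow p (le_max_left _ _)) (Nat.dvd_lcm_left _ _))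
      (mul_dvd_mul (pow_dvd_pow p (le_max_right _ _)) (Nat.dvd_lcm_right _ _))
  · refine (hl _).mul_dvd_of_dvd_of_dvd ?_ ?_
    · rcases max_choice i j with h | h <;> rw [h]
      · exact (dvd_mul_right _ _).trans (Nat.dvd_lcm_left _ _)
      · exact (dvd_mul_right _ _).trans (Nat.dvd_lcm_right _ _)
    · exact Nat.lcm_dvd ((dvd_mul_left _ _).trans (Nat.dvd_lcm_left _ _))
        ((dvd_mul_left _ _).trans (Nat.dvd_lcm_right _ _))

/-- The function `v ↦ p ^ m * f (p ^ i * v)`. -/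
def fiber (p i m : ℕ) (f : ℕ → ℝ) (v : ℕ) : ℝ := (p : ℝ) ^ m * f (p ^ i * v)

/-- The mass of `f` on the integers divisible by `p` exactly `i` times. -/
def fiberMass (p H i : ℕ) (f : ℕ → ℝ) : ℝ :=
  (Nat.totient (p ^ i) : ℝ) * mass H (fun v => f (p ^ i * v))

theorem fiberMass_nonneg {p H i : ℕ} {f : ℕ → ℝ} (hf : ∀ v, 0 ≤ f v) : 0 ≤ fiberMass p H i f :=
  mul_nonneg (Nat.cast_nonneg _) (mass_nonneg fun _ => hf _)

theorem totient_prime_pow_mul {p i v : ℕ} (hp : p.Prime) (hv : ¬ p ∣ v) :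
    (Nat.totient (p ^ i * v) : ℝ) = Nat.totient (p ^ i) * Nat.totient v := by
  rw [Nat.totient_mul (((Nat.Prime.coprime_iff_not_dvd hp).2 hv).pow_left i)]
  push_cast; rfl

theorem mass_eq_sum_fiberMass {p m e : ℕ} (hp : p.Prime) (hpm : ¬ p ∣ m) (f : ℕ → ℝ) :
    mass (p ^ e * m) f = ∑ i ∈ range (e + 1), fiberMass p m i f := by
  rw [mass, sum_divisors_prime_pow_mul hp hpm]
  refine sum_congr rfl fun i _ => ?_
  rw [fiberMass, mass, mul_sum]
  refine sum_congr rfl fun v hv => ?_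
  rw [totient_prime_pow_mul hp (fun h => hpm (h.trans (Nat.dvd_of_mem_divisors hv)))]
  ring

theorem mass_fiber (p i m H : ℕ) (f : ℕ → ℝ) :
    mass H (fiber p i m f) = (p : ℝ) ^ m * mass H (fun v => f (p ^ i * v)) := by
  simp only [mass, fiber, mul_sum, mul_assoc]

/-- The lcm gains the factor `p ^ max i j`. Absorbing it into both functions turns the edges between
two fibres into edges of the same kind on divisors of `m`. -/
theorem edgeSum_prime_pow_mul {p m e : ℕ} (hp : p.Prime) (hpm : ¬ p ∣ m) (h : ℕ → ℕ → ℝ)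
    (f g : ℕ → ℝ) :
    edgeSum h (p ^ e * m) f g = ∑ i ∈ range (e + 1), ∑ j ∈ range (e + 1),
      (Nat.totient (p ^ i) : ℝ) * Nat.totient (p ^ j) / ((p : ℝ) ^ max i j) ^ 2 *
        edgeSum (fun v w => h (p ^ i * v) (p ^ j * w)) m (fiber p i (max i j) f)
          (fiber p j (max i j) g) := by
  rw [edgeSum, sum_divisors_prime_pow_mul hp hpm]
  refine sum_congr rfl fun i _ => ?_
  simp_rw [sum_divisors_prime_pow_mul hp hpm]
  rw [sum_comm]
  refine sum_congr rfl fun j _ => ?_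
  rw [edgeSum, mul_sum]
  refine sum_congr rfl fun v hv => ?_
  rw [mul_sum]
  refine sum_congr rfl fun w hw => ?_
  have hpv : ¬ p ∣ v := fun h => hpm (h.trans (Nat.dvd_of_mem_divisors hv))
  have hpw : ¬ p ∣ w := fun h => hpm (h.trans (Nat.dvd_of_mem_divisors hw))
  have hE : IsEdge f g (p ^ i * v) (p ^ j * w) ↔
      IsEdge (fiber p i (max i j) f) (fiber p j (max i j) g) v w := by
    simp only [IsEdge, fiber, lcm_prime_pow_mul hp hpv hpw]
    push_cast
    rw [mul_left_comm (Nat.lcm v w : ℝ), mul_left_comm (Nat.lcm v w : ℝ), mul_assoc, mul_assoc]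
  have hp0 : (p : ℝ) ≠ 0 := Nat.cast_ne_zero.2 hp.ne_zero
  by_cases hedge : IsEdge (fiber p i (max i j) f) (fiber p j (max i j) g) v w
  · rw [if_pos hedge, if_pos (hE.2 hedge), totient_prime_pow_mul hp hpv,
      totient_prime_pow_mul hp hpw]
    simp only [fiber]
    field_simp
  · rw [if_neg hedge, if_neg (fun h => hedge (hE.1 h)), mul_zero]

/-- This is the source of the kernel: `i + j - 2 * max i j = -|i - j|`, and `φ(p^i) ≤ p^i`. -/
theorem totient_prime_pow_le_ker {p i j : ℕ} {s : ℝ} (hp : p.Prime) (hs1 : s < 1) :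
    ((Nat.totient (p ^ i) : ℝ) * Nat.totient (p ^ j) / ((p : ℝ) ^ max i j) ^ 2) ^ (1 - s)
      ≤ ker 1 ((p : ℝ) ^ (-(1 - s))) i j := by
  have hp0 : (0 : ℝ) < p := Nat.cast_pos.2 hp.pos
  have h1 : (Nat.totient (p ^ i) : ℝ) * Nat.totient (p ^ j) / ((p : ℝ) ^ max i j) ^ 2
      ≤ ((p : ℝ)⁻¹) ^ ((i - j) + (j - i)) := by
    have ha : (Nat.totient (p ^ i) : ℝ) ≤ (p : ℝ) ^ i := by exact_mod_cast Nat.totient_le _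
    have hb : (Nat.totient (p ^ j) : ℝ) ≤ (p : ℝ) ^ j := by exact_mod_cast Nat.totient_le _
    calc _ ≤ (p : ℝ) ^ i * (p : ℝ) ^ j / ((p : ℝ) ^ max i j) ^ 2 := by gcongr
      _ = ((p : ℝ)⁻¹) ^ ((i - j) + (j - i)) := by
        rw [div_eq_iff (by positivity), ← pow_mul, inv_pow, ← pow_add,
          show max i j * 2 = ((i - j) + (j - i)) + (i + j) by omega, pow_add _ _ (i + j),
          inv_mul_cancel_left₀ (by positivity)]
  refine (Real.rpow_le_rpow (by positivity) h1 (by linarith)).trans ?_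
  rw [← Real.rpow_natCast, ← Real.rpow_mul (by positivity), ker, offKer, one_mul]
  split_ifs with hij
  · subst hij; simp
  · rw [zero_add, mul_comm, Real.rpow_mul (by positivity), Real.inv_rpow hp0.le,
      ← Real.rpow_neg hp0.le, Real.rpow_natCast]

/-- The inductive step. The bound for `m` is homogeneous of degree `s` in each function, so of the
prefactor `φ(p^i) φ(p^j) / p^(2 max)` a power `s` turns the masses into fibre masses and the power
`1 - s` remains as the kernel. The weight `c` records what `h` gains at `p`. -/
theorem edgeSum_prime_pow_mul_le {p m e : ℕ} (hp : p.Prime) (hpm : ¬ p ∣ m) {s B : ℝ}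
    (hs1 : s < 1) (hB : 0 ≤ B) {h h' : ℕ → ℕ → ℝ} {c : ℕ → ℕ → ℝ}
    (hc : ∀ i j, 0 ≤ c i j) (hb : EdgeBound h' m s B)
    (hh : ∀ i j, ∀ v ∈ m.divisors, ∀ w ∈ m.divisors,
      h (p ^ i * v) (p ^ j * w) ≤ c i j * h' v w)
    {f g : ℕ → ℝ} (hf : ∀ v, 0 ≤ f v) (hg : ∀ w, 0 ≤ g w) :
    edgeSum h (p ^ e * m) f g ≤ B * ∑ i ∈ range (e + 1), ∑ j ∈ range (e + 1),
      c i j * ker 1 ((p : ℝ) ^ (-(1 - s))) i j *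
        (fiberMass p m i f ^ s * fiberMass p m j g ^ s) := by
  rw [edgeSum_prime_pow_mul hp hpm, mul_sum]
  refine sum_le_sum fun i _ => ?_
  rw [mul_sum]
  refine sum_le_sum fun j _ => ?_
  have hp0 : (0 : ℝ) < p := Nat.cast_pos.2 hp.pos
  set X := mass m (fun v => f (p ^ i * v)) with hX
  set Y := mass m (fun v => g (p ^ j * v)) with hY
  have hX0 : 0 ≤ X := mass_nonneg fun _ => hf _
  have hY0 : 0 ≤ Y := mass_nonneg fun _ => hg _
  have hff : ∀ v, 0 ≤ fiber p i (max i j) f v := fun v => mul_nonneg (by positivity) (hf _)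
  have hgg : ∀ v, 0 ≤ fiber p j (max i j) g v := fun v => mul_nonneg (by positivity) (hg _)
  have h1 : edgeSum (fun v w => h (p ^ i * v) (p ^ j * w)) m (fiber p i (max i j) f)
      (fiber p j (max i j) g) ≤ c i j * (B * (((p : ℝ) ^ max i j * X) ^ s *
        ((p : ℝ) ^ max i j * Y) ^ s)) := by
    refine (edgeSum_mono hff hgg (h' := fun v w => c i j * h' v w) (hh i j)).trans ?_
    rw [edgeSum_mul]
    have := hb _ _ hff hgg
    rw [mass_fiber, mass_fiber] at this
    exact mul_le_mul_of_nonneg_left this (hc i j)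
  have hti : (0 : ℝ) < Nat.totient (p ^ i) := Nat.cast_pos.2 (Nat.totient_pos.2 (pow_pos hp.pos i))
  have htj : (0 : ℝ) < Nat.totient (p ^ j) := Nat.cast_pos.2 (Nat.totient_pos.2 (pow_pos hp.pos j))
  set a : ℝ := (Nat.totient (p ^ i) : ℝ)
  set b : ℝ := (Nat.totient (p ^ j) : ℝ)
  set P : ℝ := (p : ℝ) ^ max i j with hP
  have hP0 : 0 < P := by positivity
  have h2 : a * b / P ^ 2 * ((P * X) ^ s * (P * Y) ^ s) =
      (a * b / P ^ 2) ^ (1 - s) * ((a * X) ^ s * (b * Y) ^ s) := by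
    have e1 : (P * X) ^ s * (P * Y) ^ s = ((P ^ 2) * (X * Y)) ^ s := by
      rw [← Real.mul_rpow (by positivity) (by positivity)]; congr 1; ring
    have e2 : (a * X) ^ s * (b * Y) ^ s = ((a * b / P ^ 2) * ((P ^ 2) * (X * Y))) ^ s := by
      rw [← Real.mul_rpow (by positivity) (by positivity)]; congr 1; field_simp
    have e3 : (a * b / P ^ 2) ^ (1 - s) * (a * b / P ^ 2) ^ s = a * b / P ^ 2 := by
      rw [← Real.rpow_add (by positivity), sub_add_cancel, Real.rpow_one]
    rw [e1, e2, Real.mul_rpow (x := a * b / P ^ 2) (by positivity) (by positivity),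
      ← mul_assoc ((a * b / P ^ 2) ^ (1 - s)), e3]
  calc _ ≤ a * b / P ^ 2 * (c i j * (B * ((P * X) ^ s * (P * Y) ^ s))) := by gcongr
    _ = c i j * B * (a * b / P ^ 2 * ((P * X) ^ s * (P * Y) ^ s)) := by ring
    _ = c i j * B * ((a * b / P ^ 2) ^ (1 - s) * ((a * X) ^ s * (b * Y) ^ s)) := by rw [h2]
    _ ≤ c i j * B * (ker 1 ((p : ℝ) ^ (-(1 - s))) i j * ((a * X) ^ s * (b * Y) ^ s)) := by
        have := hc i j
        gcongr
        exact totient_prime_pow_le_ker hp hs1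
    _ = _ := by
        simp only [fiberMass, ← hX, ← hY]; ring

theorem kerSum_eq_normalized {A q s X Y : ℝ} (hX : 0 < X) (hY : 0 < Y) {I J : Finset ℕ}
    {x y : ℕ → ℝ} (hx : ∀ i, 0 ≤ x i) (hy : ∀ i, 0 ≤ y i) :
    kerSum A q s I J x y =
      X ^ s * Y ^ s * kerSum A q s I J (fun i => x i / X) (fun i => y i / Y) := by
  simp only [kerSum, mul_sum]
  refine sum_congr rfl fun i _ => sum_congr rfl fun j _ => ?_
  rw [Real.div_rpow (hx i) hX.le, Real.div_rpow (hy j) hY.le]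
  have : X ^ s ≠ 0 := (Real.rpow_pos_of_pos hX s).ne'
  have : Y ^ s ≠ 0 := (Real.rpow_pos_of_pos hY s).ne'
  field_simp

/-! ### A dyadic bilinear estimate -/

/-- The sequence `c * l ^ j` crosses `1` once, and the minimum decays geometrically on both sides of
the crossing. -/
theorem sum_min_geom_le {c l : ℝ} (hc : 0 < c) (hl0 : 0 < l) (hl1 : l < 1) (n : ℕ) :
    ∑ j ∈ range n, min (c * l ^ j) (c * l ^ j)⁻¹ ≤ 2 / (1 - l) := by
  have hex : ∃ j : ℕ, c * l ^ j ≤ 1 := by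
    obtain ⟨j, hj⟩ := exists_pow_lt_of_lt_one (inv_pos.2 hc) hl1
    refine ⟨j, ?_⟩
    calc c * l ^ j ≤ c * c⁻¹ := by gcongr
      _ = 1 := mul_inv_cancel₀ hc.ne'
  classical
  set k := Nat.find hex with hk
  have hk1 : c * l ^ k ≤ 1 := Nat.find_spec hex
  calc _ ≤ ∑ j ∈ range (k + n), min (c * l ^ j) (c * l ^ j)⁻¹ :=
        sum_le_sum_of_subset_of_nonneg (range_subset_range.2 (by omega))
          (fun _ _ _ => by positivity)
    _ = ∑ j ∈ range k, min (c * l ^ (k - 1 - j)) (c * l ^ (k - 1 - j))⁻¹ +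
        ∑ j ∈ range n, min (c * l ^ (k + j)) (c * l ^ (k + j))⁻¹ := by
        rw [sum_range_add, sum_range_reflect (fun j => min (c * l ^ j) (c * l ^ j)⁻¹)]
    _ ≤ ∑ j ∈ range k, l ^ j + ∑ j ∈ range n, l ^ j := by
        refine add_le_add (sum_le_sum fun j hj => ?_) (sum_le_sum fun j hj => ?_)
        · have hj := mem_range.1 hj
          have h1 : 1 < c * l ^ (k - 1) := by
            have := Nat.find_min hex (m := k - 1) (by omega)
            exact not_le.1 this
          refine (min_le_right _ _).trans ?_
          rw [inv_le_iff_one_le_mul₀ (by positivity)]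
          calc (1 : ℝ) ≤ c * l ^ (k - 1) := h1.le
            _ = l ^ j * (c * l ^ (k - 1 - j)) := by
              rw [mul_left_comm, ← pow_add]; congr 2; omega
        · refine (min_le_left _ _).trans ?_
          rw [pow_add, ← mul_assoc]
          exact mul_le_of_le_one_left (by positivity) hk1
    _ ≤ 1 / (1 - l) + 1 / (1 - l) :=
        add_le_add (geom_sum_range_le hl0.le hl1 _) (geom_sum_range_le hl0.le hl1 _)
    _ = _ := by ring

/-- Interpolation: the two bounds for `e` are multiplied with exponents `2s - 1` and `2(1 - s)`,
which sum to `1`. -/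
theorem le_rpow_mul_of_le {s e a b X Y z : ℝ} (hs : 1 / 2 < s) (hs1 : s < 1) (he : 0 ≤ e)
    (ha : 0 ≤ a) (hb : 0 ≤ b) (hX : 0 < X) (hY : 0 < Y) (hz : 0 < z) (haX : a ≤ X) (hbY : b ≤ Y)
    (h1 : e ≤ a * b) (h2 : e ≤ z * b) :
    e ≤ X ^ s * Y ^ s * (a / X + b / Y) * (z ^ 2 * Y / X) ^ (1 - s) := by
  rcases hb.eq_or_lt with rfl | hb
  · exact (h2.trans_eq (mul_zero z)).trans (by positivity)
  set x := a / X with hx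
  set y := b / Y with hy
  have hx0 : 0 ≤ x := by positivity
  have hy0 : 0 < y := by positivity
  have hx1 : x ≤ 1 := (div_le_one hX).2 haX
  have hy1 : y ≤ 1 := (div_le_one hY).2 hbY
  have hax : a = x * X := by rw [hx]; field_simp
  have hby : b = y * Y := by rw [hy]; field_simp
  clear_value x y
  have hxy : x ^ (2 * s - 1) * y ≤ x + y := by
    set m := max x y with hm
    have hm0 : 0 ≤ m := le_max_of_le_left hx0
    have hm1 : m ≤ 1 := max_le hx1 hy1
    have : m ^ (2 * s - 1) ≤ 1 := Real.rpow_le_one hm0 hm1 (by linarith)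
    calc x ^ (2 * s - 1) * y ≤ 1 * y := by
          gcongr; exact Real.rpow_le_one hx0 hx1 (by linarith)
      _ ≤ x + y := by linarith
  have hmain : e ≤ (a * b) ^ (2 * s - 1) * (z * b) ^ (2 * (1 - s)) := by
    calc e = e ^ (2 * s - 1) * e ^ (2 * (1 - s)) := by
          rw [← Real.rpow_add' he (by ring_nf; norm_num)]
          ring_nf; rw [Real.rpow_one]
      _ ≤ _ := mul_le_mul (Real.rpow_le_rpow he h1 (by linarith))
          (Real.rpow_le_rpow he h2 (by linarith)) (by positivity) (by positivity)
  refine hmain.trans ?_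
  have e1 : (a * b) ^ (2 * s - 1) * (z * b) ^ (2 * (1 - s)) =
      (X ^ s * Y ^ s) * (x ^ (2 * s - 1) * y) * (z ^ 2 * Y / X) ^ (1 - s) := by
    rw [hax, hby, Real.mul_rpow (by positivity) (by positivity), Real.mul_rpow hx0 hX.le,
      Real.mul_rpow hy0.le hY.le, Real.mul_rpow hz.le (by positivity), Real.mul_rpow hy0.le hY.le,
      Real.div_rpow (by positivity) hX.le, Real.mul_rpow (by positivity) hY.le,
      ← Real.rpow_natCast z 2, ← Real.rpow_mul hz.le]
    have p1 : X ^ (2 * s - 1) = X ^ s / X ^ (1 - s) := by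
      rw [← Real.rpow_sub hX]; congr 1; ring
    have p2 : Y ^ (2 * s - 1) * Y ^ (2 * (1 - s)) = Y ^ s * Y ^ (1 - s) := by
      rw [← Real.rpow_add hY, ← Real.rpow_add hY]; congr 1; ring
    have p3 : y ^ (2 * s - 1) * y ^ (2 * (1 - s)) = y := by
      rw [← Real.rpow_add hy0]; ring_nf; rw [Real.rpow_one]
    calc _ = x ^ (2 * s - 1) * (y ^ (2 * s - 1) * y ^ (2 * (1 - s))) * X ^ (2 * s - 1) *
          (Y ^ (2 * s - 1) * Y ^ (2 * (1 - s))) * z ^ (2 * (1 - s)) := by ring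
      _ = _ := by rw [p1, p2, p3]; push_cast; ring
  rw [e1]
  gcongr

/-- Bilinear estimate for sparse relations: an edge `(a, c)` forces `F ≤ 1 / c` and `G ≤ 1 / a`. -/
theorem sum_relation_le {s : ℝ} (hs : 1 / 2 < s) (hs1 : s < 1) {V W : Finset ℕ} {α γ : ℕ → ℕ}
    (hα : Set.InjOn α V) (hγ : Set.InjOn γ W) (hα0 : ∀ v ∈ V, α v ≠ 0) (hγ0 : ∀ w ∈ W, γ w ≠ 0)
    {F G : ℕ → ℝ} (hF : ∀ v ∈ V, 0 ≤ F v) (hG : ∀ w ∈ W, 0 ≤ G w) {R : ℕ → ℕ → Prop}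
    [∀ v w, Decidable (R v w)]
    (hR : ∀ v ∈ V, ∀ w ∈ W, R v w → F v * γ w ≤ 1 ∧ G w * α v ≤ 1) :
    ∑ v ∈ V, ∑ w ∈ W, (if R v w then F v * G w else 0) ≤
      4 / (1 - 4 ^ (-(1 - s))) * ((∑ v ∈ V, F v) ^ s * (∑ w ∈ W, G w) ^ s) := by
  set l : ℝ := 4 ^ (-(1 - s)) with hl
  have hl0 : 0 < l := by positivity
  have hl1 : l < 1 := Real.rpow_lt_one_of_one_lt_of_neg (by norm_num) (by linarith)
  have hl1' : 0 < 1 - l := by linarith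
  set X := ∑ v ∈ V, F v with hX
  set Y := ∑ w ∈ W, G w with hY
  have hX0 : 0 ≤ X := sum_nonneg hF
  have hY0 : 0 ≤ Y := sum_nonneg hG
  rcases hX0.eq_or_lt with hX0 | hX0
  · have hz : ∀ v ∈ V, F v = 0 := (sum_eq_zero_iff_of_nonneg hF).1 hX0.symm
    rw [sum_eq_zero (fun v hv => sum_eq_zero (fun w _ => by rw [hz v hv]; simp))]
    positivity
  rcases hY0.eq_or_lt with hY0 | hY0
  · have hz : ∀ w ∈ W, G w = 0 := (sum_eq_zero_iff_of_nonneg hG).1 hY0.symm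
    rw [sum_eq_zero (fun v hv => sum_eq_zero (fun w hw => by rw [hz w hw]; simp))]
    positivity
  obtain ⟨n, hn⟩ : ∃ n, (V.image fun v => Nat.log 2 (α v)) ∪ (W.image fun w => Nat.log 2 (γ w))
      ⊆ range n := exists_nat_subset_range _
  set Vi : ℕ → Finset ℕ := fun i => V.filter fun v => Nat.log 2 (α v) = i with hVi
  set Wj : ℕ → Finset ℕ := fun j => W.filter fun w => Nat.log 2 (γ w) = j with hWj
  have hsV : ∀ f : ℕ → ℝ, ∑ v ∈ V, f v = ∑ i ∈ range n, ∑ v ∈ Vi i, f v := fun f =>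
    (sum_fiberwise_of_maps_to (fun v hv => hn (mem_union_left _ (mem_image_of_mem _ hv))) f).symm
  have hsW : ∀ f : ℕ → ℝ, ∑ w ∈ W, f w = ∑ j ∈ range n, ∑ w ∈ Wj j, f w := fun f =>
    (sum_fiberwise_of_maps_to (fun v hv => hn (mem_union_right _ (mem_image_of_mem _ hv))) f).symm
  have hcard : ∀ (U : Finset ℕ) (β : ℕ → ℕ), Set.InjOn β U → (∀ v ∈ U, β v ≠ 0) → ∀ i,
      ((U.filter fun v => Nat.log 2 (β v) = i).card : ℝ) ≤ 2 ^ i := by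
    intro U β hβ hβ0 i
    have h1 : (U.filter fun v => Nat.log 2 (β v) = i).card ≤ (Ico (2 ^ i) (2 ^ (i + 1))).card := by
      refine card_le_card_of_injOn β (fun v hv => ?_) (hβ.mono (coe_subset.2 (filter_subset _ _)))
      have hv := mem_filter.1 hv
      rw [coe_Ico, Set.mem_Ico, ← hv.2]
      exact ⟨Nat.pow_log_le_self 2 (hβ0 v hv.1), Nat.lt_pow_succ_log_self (by norm_num) _⟩
    rw [Nat.card_Ico, pow_succ] at h1
    have : (U.filter fun v => Nat.log 2 (β v) = i).card ≤ 2 ^ i := by omega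
    exact_mod_cast this
  set e : ℕ → ℕ → ℝ := fun i j => ∑ v ∈ Vi i, ∑ w ∈ Wj j, (if R v w then F v * G w else 0) with he
  set x : ℕ → ℝ := fun i => ∑ v ∈ Vi i, F v with hx
  set y : ℕ → ℝ := fun j => ∑ w ∈ Wj j, G w with hy
  have hFi : ∀ i, ∀ v ∈ Vi i, 0 ≤ F v := fun i v hv => hF v (mem_filter.1 hv).1
  have hGj : ∀ j, ∀ w ∈ Wj j, 0 ≤ G w := fun j w hw => hG w (mem_filter.1 hw).1
  have hx0 : ∀ i, 0 ≤ x i := fun i => sum_nonneg (hFi i)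
  have hy0 : ∀ j, 0 ≤ y j := fun j => sum_nonneg (hGj j)
  have hxX : ∀ i, x i ≤ X := fun i =>
    sum_le_sum_of_subset_of_nonneg (filter_subset _ _) (fun v hv _ => hF v hv)
  have hyY : ∀ j, y j ≤ Y := fun j =>
    sum_le_sum_of_subset_of_nonneg (filter_subset _ _) (fun v hv _ => hG v hv)
  have he0 : ∀ i j, 0 ≤ e i j := fun i j => sum_nonneg fun v hv => sum_nonneg fun w hw => by
    split_ifs
    · exact mul_nonneg (hFi i v hv) (hGj j w hw)
    · exact le_rfl
  have he1 : ∀ i j, e i j ≤ x i * y j := by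
    intro i j
    rw [hx, hy, sum_mul_sum]
    refine sum_le_sum fun v hv => sum_le_sum fun w hw => ?_
    split_ifs
    · exact le_rfl
    · exact mul_nonneg (hFi i v hv) (hGj j w hw)
  -- A related pair has `F v ≤ 2^(-j)`, and by injectivity of `α` the dyadic block `Vi i` has at
  -- most `2^i` elements.
  have he2 : ∀ i j, e i j ≤ ((2 : ℝ) ^ i / 2 ^ j) * y j := by
    intro i j
    calc e i j ≤ ∑ v ∈ Vi i, ∑ w ∈ Wj j, 1 / 2 ^ j * G w := by
          refine sum_le_sum fun v hv => sum_le_sum fun w hw => ?_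
          have hGw := hGj j w hw
          split_ifs with hvw
          · refine mul_le_mul_of_nonneg_right ?_ hGw
            have hv' := (mem_filter.1 hv)
            have hw' := (mem_filter.1 hw)
            have h1 := (hR v hv'.1 w hw'.1 hvw).1
            have h2 : (2 : ℝ) ^ j ≤ γ w := by
              have := Nat.pow_log_le_self 2 (hγ0 w hw'.1)
              rw [hw'.2] at this; exact_mod_cast this
            rw [le_div_iff₀ (by positivity)]
            exact (mul_le_mul_of_nonneg_left h2 (hFi i v hv)).trans h1
          · positivity
      _ = (Vi i).card * (1 / 2 ^ j * y j) := by
          simp only [hy, sum_const, nsmul_eq_mul, mul_sum]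
      _ ≤ 2 ^ i * (1 / 2 ^ j * y j) := by
          have := hy0 j
          gcongr; exact hcard V α hα hα0 i
      _ = _ := by ring
  have he3 : ∀ i j, e i j ≤ ((2 : ℝ) ^ j / 2 ^ i) * x i := by
    intro i j
    calc e i j ≤ ∑ v ∈ Vi i, ∑ w ∈ Wj j, F v * (1 / 2 ^ i) := by
          refine sum_le_sum fun v hv => sum_le_sum fun w hw => ?_
          have hFv := hFi i v hv
          split_ifs with hvw
          · refine mul_le_mul_of_nonneg_left ?_ hFv
            have hv' := (mem_filter.1 hv)
            have hw' := (mem_filter.1 hw)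
            have h1 := (hR v hv'.1 w hw'.1 hvw).2
            have h2 : (2 : ℝ) ^ i ≤ α v := by
              have := Nat.pow_log_le_self 2 (hα0 v hv'.1)
              rw [hv'.2] at this; exact_mod_cast this
            rw [le_div_iff₀ (by positivity)]
            exact (mul_le_mul_of_nonneg_left h2 (hGj j w hw)).trans h1
          · positivity
      _ = (Wj j).card * (1 / 2 ^ i * x i) := by
          simp_rw [sum_const, nsmul_eq_mul, hx, mul_sum]
          exact sum_congr rfl fun v _ => by ring
      _ ≤ 2 ^ j * (1 / 2 ^ i * x i) := by
          have := hx0 i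
          gcongr; exact hcard W γ hγ hγ0 j
      _ = _ := by ring
  -- Interpolating the trivial bound with `he2` gives the factor `ρ`, and with `he3` its inverse.
  -- Since `ρ` is geometric in `i` and in `j` with ratio `4^(1-s)` or its inverse, rows and columns
  -- of the minimum are summable uniformly in `X / Y`.
  set ρ : ℕ → ℕ → ℝ := fun i j => (((2 : ℝ) ^ i / 2 ^ j) ^ 2 * Y / X) ^ (1 - s) with hρ
  have hρ0 : ∀ i j, 0 < ρ i j := fun i j => by rw [hρ]; positivity
  have hemin : ∀ i j, e i j ≤ X ^ s * Y ^ s * (x i / X + y j / Y) * min (ρ i j) (ρ i j)⁻¹ := by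
    intro i j
    have h1 : e i j ≤ X ^ s * Y ^ s * (x i / X + y j / Y) * ρ i j :=
      le_rpow_mul_of_le hs hs1 (he0 i j) (hx0 i) (hy0 j) hX0 hY0 (by positivity) (hxX i) (hyY j)
        (he1 i j) (he2 i j)
    have h2 : e i j ≤ X ^ s * Y ^ s * (x i / X + y j / Y) * (ρ i j)⁻¹ := by
      have := le_rpow_mul_of_le hs hs1 (he0 i j) (hy0 j) (hx0 i) hY0 hX0
        (z := (2 : ℝ) ^ j / 2 ^ i) (by positivity) (hyY j) (hxX i)
        ((he1 i j).trans_eq (mul_comm _ _)) (he3 i j)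
      have hinv : (ρ i j)⁻¹ = (((2 : ℝ) ^ j / 2 ^ i) ^ 2 * X / Y) ^ (1 - s) := by
        rw [hρ, ← Real.inv_rpow (by positivity)]
        congr 1; field_simp
      rw [hinv]
      calc _ ≤ _ := this
        _ = _ := by ring
    rcases min_choice (ρ i j) (ρ i j)⁻¹ with h | h <;> rw [h]
    · exact h1
    · exact h2
  have hlpow : ∀ i : ℕ, ((4 : ℝ) ^ i) ^ (1 - s) = (l ^ i)⁻¹ := by
    intro i
    rw [hl, ← Real.rpow_natCast, ← Real.rpow_natCast, ← Real.rpow_mul (by norm_num),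
      ← Real.rpow_mul (by norm_num), ← Real.rpow_neg (by norm_num)]
    congr 1; ring
  have hρeq : ∀ i j, ρ i j = (Y / X) ^ (1 - s) * (l ^ i)⁻¹ * l ^ j := by
    intro i j
    have h4 : ((2 : ℝ) ^ i / 2 ^ j) ^ 2 * Y / X = (Y / X) * 4 ^ i / 4 ^ j := by
      rw [div_pow, ← pow_mul, ← pow_mul, mul_comm i, mul_comm j, pow_mul, pow_mul]
      norm_num; ring
    rw [hρ]
    simp only [h4]
    rw [Real.div_rpow (by positivity) (by positivity),
      Real.mul_rpow (by positivity) (by positivity), hlpow, hlpow, div_inv_eq_mul]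
  have hκ : 0 < (Y / X) ^ (1 - s) := by positivity
  have hrow : ∀ i, ∑ j ∈ range n, min (ρ i j) (ρ i j)⁻¹ ≤ 2 / (1 - l) := by
    intro i
    simp_rw [hρeq]
    exact sum_min_geom_le (by positivity) hl0 hl1 n
  have hcol : ∀ j, ∑ i ∈ range n, min (ρ i j) (ρ i j)⁻¹ ≤ 2 / (1 - l) := by
    intro j
    have h1 : ∀ i, min (ρ i j) (ρ i j)⁻¹ =
        min ((((Y / X) ^ (1 - s))⁻¹ * (l ^ j)⁻¹) * l ^ i)
          ((((Y / X) ^ (1 - s))⁻¹ * (l ^ j)⁻¹) * l ^ i)⁻¹ := by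
      intro i
      rw [min_comm, hρeq]
      congr 1
      · rw [mul_inv, mul_inv, inv_inv]; ring
      · rw [mul_inv, mul_inv, inv_inv, inv_inv]; ring
    simp_rw [h1]
    exact sum_min_geom_le (by positivity) hl0 hl1 n
  have hsx : ∑ i ∈ range n, x i / X = 1 := by
    rw [← sum_div, ← hsV F]; exact div_self hX0.ne'
  have hsy : ∑ j ∈ range n, y j / Y = 1 := by
    rw [← sum_div, ← hsW G]; exact div_self hY0.ne'
  calc ∑ v ∈ V, ∑ w ∈ W, (if R v w then F v * G w else 0)
      = ∑ i ∈ range n, ∑ j ∈ range n, e i j := by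
        rw [hsV]
        refine sum_congr rfl fun i _ => ?_
        simp_rw [hsW]
        rw [sum_comm]
    _ ≤ ∑ i ∈ range n, ∑ j ∈ range n,
        X ^ s * Y ^ s * (x i / X + y j / Y) * min (ρ i j) (ρ i j)⁻¹ :=
        sum_le_sum fun i _ => sum_le_sum fun j _ => hemin i j
    _ = X ^ s * Y ^ s * (∑ i ∈ range n, x i / X * ∑ j ∈ range n, min (ρ i j) (ρ i j)⁻¹ +
        ∑ j ∈ range n, y j / Y * ∑ i ∈ range n, min (ρ i j) (ρ i j)⁻¹) := by
        simp_rw [mul_sum]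
        rw [sum_comm (s := range n) (t := range n)
          (f := fun j i => y j / Y * min (ρ i j) (ρ i j)⁻¹), ← sum_add_distrib, mul_sum]
        refine sum_congr rfl fun i _ => ?_
        rw [← sum_add_distrib, mul_sum]
        refine sum_congr rfl fun j _ => ?_
        ring
    _ ≤ X ^ s * Y ^ s * (∑ i ∈ range n, x i / X * (2 / (1 - l)) +
        ∑ j ∈ range n, y j / Y * (2 / (1 - l))) := by
        gcongr with i _ j _
        · exact div_nonneg (hx0 i) hX0.le
        · exact hrow i
        · exact div_nonneg (hy0 j) hY0.le
        · exact hcol j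
    _ = _ := by rw [← sum_mul, ← sum_mul, hsx, hsy]; ring

/-! ### Totient inequalities and the estimate for near pairs -/

theorem totient_eq_mul_prod_real (n : ℕ) :
    (Nat.totient n : ℝ) = n * ∏ p ∈ n.primeFactors, (1 - (p : ℝ)⁻¹) := by
  simpa using congrArg (Rat.cast : ℚ → ℝ) (Nat.totient_eq_mul_prod_factors n)

theorem inv_prime_le_half {p : ℕ} (hp : p.Prime) : (p : ℝ)⁻¹ ≤ 1 / 2 := by
  rw [one_div]
  exact inv_anti₀ (by norm_num) (by exact_mod_cast hp.two_le)

theorem prod_one_sub_inv_le_of_subset {S T : Finset ℕ} (hST : S ⊆ T) (hT : ∀ p ∈ T, p.Prime) :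
    ∏ p ∈ T, (1 - (p : ℝ)⁻¹) ≤ ∏ p ∈ S, (1 - (p : ℝ)⁻¹) := by
  rw [← prod_sdiff hST]
  have h0 : ∀ p ∈ T, (0 : ℝ) ≤ 1 - (p : ℝ)⁻¹ := fun p hp => by
    linarith [inv_prime_le_half (hT p hp)]
  refine mul_le_of_le_one_left (prod_nonneg fun p hp => h0 p (hST hp)) ?_
  refine prod_le_one (fun p hp => h0 p (mem_sdiff.1 hp).1) fun p _ => ?_
  have : (0 : ℝ) ≤ (p : ℝ)⁻¹ := by positivity
  linarith

theorem totient_mul_le (a b : ℕ) : Nat.totient (a * b) ≤ a * Nat.totient b := by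
  rcases eq_or_ne a 0 with rfl | ha
  · simp
  rcases eq_or_ne b 0 with rfl | hb
  · simp
  have : (Nat.totient (a * b) : ℝ) ≤ a * Nat.totient b := by
    rw [totient_eq_mul_prod_real, totient_eq_mul_prod_real b, ← mul_assoc, Nat.cast_mul]
    refine mul_le_mul_of_nonneg_left ?_ (by positivity)
    exact prod_one_sub_inv_le_of_subset
      (Nat.primeFactors_mono (dvd_mul_left b a) (mul_ne_zero ha hb))
      (fun p hp => Nat.prime_of_mem_primeFactors hp)
  exact_mod_cast this

/-- Primes of `N` missing from `v` have `∑ 1/p ≤ 1`, and `(1 - x) * exp (2x) ≥ 1` for `0 ≤ x ≤ 1/2`,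
so they change `φ(N)/N` by a factor `exp 2` at most. -/
theorem totient_mul_le_exp {v N : ℕ}
    (h : ∑ p ∈ N.primeFactors \ v.primeFactors, (p : ℝ)⁻¹ ≤ 1) :
    (Nat.totient v : ℝ) * N ≤ Real.exp 2 * (Nat.totient N * v) := by
  set S := N.primeFactors \ v.primeFactors with hS
  have hSp : ∀ p ∈ S, p.Prime := fun p hp => Nat.prime_of_mem_primeFactors (mem_sdiff.1 hp).1
  have h1 : 1 ≤ (∏ p ∈ S, (1 - (p : ℝ)⁻¹)) * Real.exp 2 := by
    calc (1 : ℝ) = ∏ p ∈ S, (1 : ℝ) := by simp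
      _ ≤ ∏ p ∈ S, ((1 - (p : ℝ)⁻¹) * Real.exp (2 * (p : ℝ)⁻¹)) := by
          refine prod_le_prod (fun _ _ => zero_le_one) fun p hp => ?_
          have h2 := inv_prime_le_half (hSp p hp)
          have h3 : (0 : ℝ) ≤ (p : ℝ)⁻¹ := by positivity
          have h4 := Real.add_one_le_exp (2 * (p : ℝ)⁻¹)
          have h5 := mul_le_mul_of_nonneg_left h4 (by linarith : (0 : ℝ) ≤ 1 - (p : ℝ)⁻¹)
          nlinarith
      _ = (∏ p ∈ S, (1 - (p : ℝ)⁻¹)) * Real.exp (2 * ∑ p ∈ S, (p : ℝ)⁻¹) := by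
          rw [prod_mul_distrib, ← Real.exp_sum, mul_sum]
      _ ≤ _ := by
          have : (0 : ℝ) ≤ ∏ p ∈ S, (1 - (p : ℝ)⁻¹) := prod_nonneg fun p hp => by
            linarith [inv_prime_le_half (hSp p hp)]
          gcongr
          linarith
  have h2 : ∏ p ∈ v.primeFactors, (1 - (p : ℝ)⁻¹) ≤
      Real.exp 2 * ∏ p ∈ N.primeFactors, (1 - (p : ℝ)⁻¹) := by
    have hsub : N.primeFactors \ S ⊆ v.primeFactors := by
      rw [hS, sdiff_sdiff_right_self]; exact inter_subset_right
    have h3 := prod_one_sub_inv_le_of_subset hsub (fun p hp => Nat.prime_of_mem_primeFactors hp)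
    have h0 : (0 : ℝ) ≤ ∏ p ∈ N.primeFactors \ S, (1 - (p : ℝ)⁻¹) := prod_nonneg fun p hp => by
      linarith [inv_prime_le_half (Nat.prime_of_mem_primeFactors (mem_sdiff.1 hp).1)]
    have h4 := mul_le_mul_of_nonneg_left h1 h0
    rw [← prod_sdiff (show S ⊆ N.primeFactors from sdiff_subset)]
    linarith
  rw [totient_eq_mul_prod_real, totient_eq_mul_prod_real N]
  have h5 := mul_le_mul_of_nonneg_left h2 (by positivity : (0 : ℝ) ≤ (v : ℝ) * N)
  linarith

/-- It follows from `φ(N) / b ≤ φ(N / b)` and `∑ φ(d) = N` over `d ∣ N`. It supplies the weights for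
Jensen's inequality over the classes of `N / gcd(v, N)`. -/
theorem sum_totient_div_le_one {N : ℕ} (hN : N ≠ 0) :
    ∑ b ∈ N.divisors, (Nat.totient N / N : ℝ) / b ≤ 1 := by
  have hN0 : (0 : ℝ) < N := by positivity
  calc _ ≤ ∑ b ∈ N.divisors, (Nat.totient (N / b) : ℝ) / N := by
        refine sum_le_sum fun b hb => ?_
        have hbN := Nat.dvd_of_mem_divisors hb
        have hb0 : (0 : ℝ) < b := Nat.cast_pos.2 (Nat.pos_of_mem_divisors hb)
        rw [div_div, mul_comm, ← div_div]
        gcongr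
        rw [div_le_iff₀ hb0]
        have := totient_mul_le b (N / b)
        rw [Nat.mul_div_cancel' hbN] at this
        rw [mul_comm]
        exact_mod_cast this
    _ = 1 := by
        rw [← sum_div, Nat.sum_div_divisors N (fun d => (Nat.totient d : ℝ)), ← Nat.cast_sum,
          Nat.sum_totient, div_self hN0.ne']

/-- Jensen's inequality for the concave power `s`, with weights of total at most `1`. -/
theorem sum_mul_rpow_le {ι : Type*} {s : ℝ} (hs : 0 < s) (hs1 : s < 1) {S : Finset ι}
    {β X : ι → ℝ} (hβ : ∀ i ∈ S, 0 ≤ β i) (hβ1 : ∑ i ∈ S, β i ≤ 1) (hX : ∀ i ∈ S, 0 ≤ X i) :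
    ∑ i ∈ S, β i * X i ^ s ≤ (∑ i ∈ S, β i * X i) ^ s := by
  set T := ∑ i ∈ S, β i * X i with hT
  have hn : ∀ i ∈ S, 0 ≤ β i * X i := fun i hi => mul_nonneg (hβ i hi) (hX i hi)
  have hT0 : 0 ≤ T := sum_nonneg hn
  rcases hT0.eq_or_lt with h | h
  · have hz := (sum_eq_zero_iff_of_nonneg hn).1 h.symm
    rw [← h, Real.zero_rpow hs.ne']
    refine (sum_eq_zero fun i hi => ?_).le
    rcases mul_eq_zero.1 (hz i hi) with h' | h' <;> simp [h', Real.zero_rpow hs.ne']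
  · have hpt : ∀ i ∈ S, β i * X i ^ s ≤ T ^ s * ((1 - s) * β i + s / T * (β i * X i)) := by
      intro i hi
      have h1 := Real.geom_mean_le_arith_mean2_weighted hs.le (by linarith : 0 ≤ 1 - s)
        (div_nonneg (hX i hi) hT0) zero_le_one (by ring)
      rw [Real.one_rpow, mul_one, mul_one, Real.div_rpow (hX i hi) hT0,
        div_le_iff₀ (by positivity)] at h1
      calc β i * X i ^ s ≤ β i * ((s * (X i / T) + (1 - s)) * T ^ s) :=
            mul_le_mul_of_nonneg_left h1 (hβ i hi)
        _ = _ := by ring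
    refine (sum_le_sum hpt).trans ?_
    rw [← mul_sum, sum_add_distrib, ← mul_sum, ← mul_sum, ← hT, div_mul_cancel₀ _ h.ne']
    have h1 : (1 - s) * ∑ i ∈ S, β i + s ≤ 1 := by nlinarith
    exact mul_le_of_le_one_right (by positivity) h1

/-- `v` and `w` agree with `N` at every prime of `H`, one of them at least, and they disagree
with one another at few primes only. -/
def NearPair (H N v w : ℕ) : Prop :=
  (∀ p ∈ H.primeFactors, v.factorization p = N.factorization p ∨
    w.factorization p = N.factorization p) ∧
  ∑ p ∈ H.primeFactors with v.factorization p ≠ w.factorization p, (p : ℝ)⁻¹ ≤ 1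

theorem NearPair.symm {H N v w : ℕ} (h : NearPair H N v w) : NearPair H N w v :=
  ⟨fun p hp => (h.1 p hp).symm, by simpa only [ne_comm] using h.2⟩

theorem NearPair.totient_le {H N v w : ℕ} (h : NearPair H N v w)
    (hNH : N.primeFactors ⊆ H.primeFactors) :
    (Nat.totient v : ℝ) * N ≤ Real.exp 2 * (Nat.totient N * v) := by
  refine totient_mul_le_exp (le_trans ?_ h.2)
  refine sum_le_sum_of_subset_of_nonneg (fun p hp => ?_) (fun _ _ _ => by positivity)
  obtain ⟨hpN, hpv⟩ := mem_sdiff.1 hp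
  rw [← Nat.support_factorization, Finsupp.mem_support_iff] at hpN
  rw [← Nat.support_factorization, Finsupp.notMem_support_iff] at hpv
  have hpH : p ∈ H.primeFactors := hNH (mem_sdiff.1 hp).1
  refine mem_filter.2 ⟨hpH, ?_⟩
  rcases h.1 p hpH with h' | h'
  · exact absurd (hpv ▸ h') hpN.symm
  · rw [hpv, h']; exact hpN.symm

/-- At each prime one of the two valuations equals that of `N`, so only the other can exceed it, and
the larger valuation is that of `N` plus this excess. -/
theorem NearPair.mul_dvd_lcm {H N v w : ℕ} (h : NearPair H N v w) (hN : N ≠ 0)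
    (hNH : N.primeFactors ⊆ H.primeFactors) (hvH : v ∈ H.divisors) (hwH : w ∈ H.divisors) :
    N * (v / Nat.gcd v N) * (w / Nat.gcd w N) ∣ Nat.lcm v w := by
  obtain ⟨hvH, hH⟩ := Nat.mem_divisors.1 hvH
  have hwH := Nat.dvd_of_mem_divisors hwH
  have hv : v ≠ 0 := ne_zero_of_dvd_ne_zero hH hvH
  have hw : w ≠ 0 := ne_zero_of_dvd_ne_zero hH hwH
  have hgv : Nat.gcd v N ∣ v := Nat.gcd_dvd_left _ _
  have hgw : Nat.gcd w N ∣ w := Nat.gcd_dvd_left _ _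
  have ha : v / Nat.gcd v N ≠ 0 := (Nat.div_pos (Nat.le_of_dvd (Nat.pos_of_ne_zero hv) hgv)
    (Nat.gcd_pos_of_pos_left _ (Nat.pos_of_ne_zero hv))).ne'
  have hc : w / Nat.gcd w N ≠ 0 := (Nat.div_pos (Nat.le_of_dvd (Nat.pos_of_ne_zero hw) hgw)
    (Nat.gcd_pos_of_pos_left _ (Nat.pos_of_ne_zero hw))).ne'
  rw [← Nat.factorization_le_iff_dvd (mul_ne_zero (mul_ne_zero hN ha) hc) (Nat.lcm_ne_zero hv hw)]
  intro p
  rw [Nat.factorization_mul (mul_ne_zero hN ha) hc, Nat.factorization_mul hN ha,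
    Nat.factorization_div hgv, Nat.factorization_div hgw, Nat.factorization_lcm hv hw,
    Nat.factorization_gcd hv hN, Nat.factorization_gcd hw hN]
  simp only [Finsupp.add_apply, Finsupp.tsub_apply, Finsupp.inf_apply, Finsupp.sup_apply]
  by_cases hpH : p ∈ H.primeFactors
  · have := h.1 p hpH
    omega
  · have hz : ∀ n : ℕ, n.primeFactors ⊆ H.primeFactors → n.factorization p = 0 := fun n hn => by
      rw [← Finsupp.notMem_support_iff, Nat.support_factorization]
      exact fun h => hpH (hn h)
    rw [hz N hNH, hz v (Nat.primeFactors_mono hvH hH), hz w (Nat.primeFactors_mono hwH hH)]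
    simp

-- Write `v = N * a / b` in lowest terms. For fixed `b` the number `a` determines `v`, and an edge
-- bounds the rescaled `F v` by `1 / a w`, which is the setting of `sum_relation_le`. The classes
-- are recombined by Jensen with weights `φ(N) / (N b)`.
open Classical in
theorem edgeSum_nearPair_le {s : ℝ} (hs : 1 / 2 < s) (hs1 : s < 1) {H N : ℕ} (hN : N ≠ 0)
    (hNH : N.primeFactors ⊆ H.primeFactors) :
    EdgeBound (fun v w => if NearPair H N v w then 1 else 0) H s
      (4 / (1 - 4 ^ (-(1 - s))) * Real.exp 2 ^ 2) := by
  intro f g hf hg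
  set C : ℝ := 4 / (1 - 4 ^ (-(1 - s))) with hC
  have hl1 : (4 : ℝ) ^ (-(1 - s)) < 1 :=
    Real.rpow_lt_one_of_one_lt_of_neg (by norm_num) (by linarith)
  have hC0 : 0 < C := div_pos (by norm_num) (by linarith)
  have hs0 : 0 < s := by linarith
  set τ : ℝ := Nat.totient N / N with hτ
  have hN0 : (0 : ℝ) < N := by positivity
  have hφN : (0 : ℝ) < Nat.totient N := Nat.cast_pos.2 (Nat.totient_pos.2 (Nat.pos_of_ne_zero hN))
  have hτ0 : 0 < τ := by positivity
  set E : ℝ := Real.exp 2 with hE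
  have hE0 : 0 < E := Real.exp_pos 2
  have hE1 : 1 ≤ E := Real.one_le_exp (by norm_num)
  set b : ℕ → ℕ := fun v => N / Nat.gcd v N with hb
  set a : ℕ → ℕ := fun v => v / Nat.gcd v N with ha
  have hgcd0 : ∀ v, 0 < Nat.gcd v N := fun v => Nat.gcd_pos_of_pos_right _ (Nat.pos_of_ne_zero hN)
  have hb0 : ∀ v, 0 < b v := fun v => Nat.div_pos
    (Nat.le_of_dvd (Nat.pos_of_ne_zero hN) (Nat.gcd_dvd_right v N)) (hgcd0 v)
  have hbdvd : ∀ v, b v ∈ N.divisors := fun v =>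
    Nat.mem_divisors.2 ⟨Nat.div_dvd_of_dvd (Nat.gcd_dvd_right v N), hN⟩
  have hvb : ∀ v, v * b v = N * a v := by
    intro v
    have h1 := Nat.div_mul_cancel (Nat.gcd_dvd_right v N)
    have h2 := Nat.div_mul_cancel (Nat.gcd_dvd_left v N)
    calc v * b v = (a v * Nat.gcd v N) * b v := by rw [ha, h2]
      _ = (b v * Nat.gcd v N) * a v := by ring
      _ = N * a v := by rw [hb, h1]
  have ha0 : ∀ v ∈ H.divisors, a v ≠ 0 := by
    intro v hv h
    have := hvb v
    rw [h, mul_zero] at this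
    have := mul_pos (Nat.pos_of_mem_divisors hv) (hb0 v)
    omega
  set V : ℕ → Finset ℕ := fun d => H.divisors.filter fun v => b v = d with hV
  have hinj : ∀ d, Set.InjOn a (V d) := by
    intro d v hv w hw hvw
    have hv' := (mem_filter.1 hv).2
    have hw' := (mem_filter.1 hw).2
    have h1 := hvb v
    have h2 := hvb w
    rw [hvw, ← h2, hv', hw'] at h1
    exact Nat.eq_of_mul_eq_mul_right (hv' ▸ hb0 v) h1
  have hsplit : ∀ F : ℕ → ℝ, ∑ v ∈ H.divisors, F v = ∑ d ∈ N.divisors, ∑ v ∈ V d, F v :=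
    fun F => (sum_fiberwise_of_maps_to (fun v _ => hbdvd v) F).symm
  -- The scaling is forced by `φ(v) ≤ E τ v` and `v * b v = N * a v`: they give `F v ≤ f v * N * a
  -- v`, whose product with `a w` is at most `f v * lcm(v, w)`.
  set F : (ℕ → ℝ) → ℕ → ℝ := fun f v => f v * Nat.totient v * b v / (τ * E) with hFdef
  have hF0 : ∀ f : ℕ → ℝ, (∀ v, 0 ≤ f v) → ∀ v, 0 ≤ F f v := fun f hf v => by
    have := hf v
    rw [hFdef]; positivity
  have hFle : ∀ f : ℕ → ℝ, (∀ v, 0 ≤ f v) → ∀ v ∈ H.divisors, ∀ w ∈ H.divisors,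
      NearPair H N v w → (Nat.lcm v w : ℝ) * f v ≤ 1 → F f v * a w ≤ 1 := by
    intro f hf v hv w hw hvw hle
    have hfv := hf v
    have h1 : (Nat.totient v : ℝ) ≤ E * τ * v := by
      have := hvw.totient_le hNH
      rw [← le_div_iff₀ hN0] at this
      calc _ ≤ _ := this
        _ = _ := by rw [hτ, hE]; ring
    have h2 : (v : ℝ) * b v = N * a v := by exact_mod_cast hvb v
    have h3 : (N : ℝ) * a v * a w ≤ Nat.lcm v w := by
      have := Nat.le_of_dvd (Nat.pos_of_ne_zero (Nat.lcm_ne_zero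
        (Nat.pos_of_mem_divisors hv).ne' (Nat.pos_of_mem_divisors hw).ne'))
        (hvw.mul_dvd_lcm hN hNH hv hw)
      exact_mod_cast this
    calc F f v * a w ≤ f v * (E * τ * v) * b v / (τ * E) * a w := by
          rw [hFdef]; dsimp only; gcongr
      _ = f v * (v * b v) * a w := by field_simp
      _ = f v * (N * a v * a w) := by rw [h2]; ring
      _ ≤ f v * Nat.lcm v w := by gcongr
      _ ≤ 1 := by rw [mul_comm]; exact hle
  set X : (ℕ → ℝ) → ℕ → ℝ := fun f d => ∑ v ∈ V d, F f v with hX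
  have hX0 : ∀ f : ℕ → ℝ, (∀ v, 0 ≤ f v) → ∀ d, 0 ≤ X f d := fun f hf d =>
    sum_nonneg fun v _ => hF0 f hf v
  have hJ : ∀ f : ℕ → ℝ, (∀ v, 0 ≤ f v) →
      ∑ d ∈ N.divisors, τ / d * X f d ^ s ≤ mass H f ^ s := by
    intro f hf
    have h1 := sum_mul_rpow_le hs0 hs1 (S := N.divisors) (β := fun d => τ / d) (X := X f)
      (fun d _ => by positivity) (sum_totient_div_le_one hN) (fun d _ => hX0 f hf d)
    refine h1.trans (Real.rpow_le_rpow (sum_nonneg fun d _ =>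
      mul_nonneg (by positivity) (hX0 f hf d)) ?_ hs0.le)
    rw [mass, hsplit]
    refine sum_le_sum fun d hd => ?_
    have hd0 : (0 : ℝ) < d := Nat.cast_pos.2 (Nat.pos_of_mem_divisors hd)
    rw [hX, mul_sum]
    refine sum_le_sum fun v hv => ?_
    have hbv : b v = d := (mem_filter.1 hv).2
    have hfv := hf v
    calc τ / d * F f v = f v * Nat.totient v / E := by
          rw [hFdef]; simp only [hbv]; field_simp
      _ ≤ f v * Nat.totient v := div_le_self (by positivity) hE1
  calc edgeSum (fun v w => if NearPair H N v w then 1 else 0) H f g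
      = ∑ d ∈ N.divisors, ∑ d' ∈ N.divisors, (τ * E) ^ 2 / (d * d') *
        ∑ v ∈ V d, ∑ w ∈ V d',
          (if IsEdge f g v w ∧ NearPair H N v w then F f v * F g w else 0) := by
        rw [edgeSum, hsplit]
        refine sum_congr rfl fun d hd => ?_
        simp_rw [hsplit, mul_sum]
        rw [sum_comm]
        refine sum_congr rfl fun d' hd' => sum_congr rfl fun v hv => sum_congr rfl fun w hw => ?_
        have hd0 : (d : ℝ) ≠ 0 := Nat.cast_ne_zero.2 (Nat.pos_of_mem_divisors hd).ne'
        have hd0' : (d' : ℝ) ≠ 0 := Nat.cast_ne_zero.2 (Nat.pos_of_mem_divisors hd').ne'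
        have hbv : b v = d := (mem_filter.1 hv).2
        have hbw : b w = d' := (mem_filter.1 hw).2
        by_cases h1 : IsEdge f g v w
        · by_cases h2 : NearPair H N v w
          · rw [if_pos h1, if_pos h2, if_pos ⟨h1, h2⟩, hFdef]
            simp only [hbv, hbw]; field_simp
          · rw [if_pos h1, if_neg h2, if_neg (fun h => h2 h.2)]; simp
        · rw [if_neg h1, if_neg (fun h => h1 h.1), mul_zero]
    _ ≤ ∑ d ∈ N.divisors, ∑ d' ∈ N.divisors, (τ * E) ^ 2 / (d * d') *
        (C * (X f d ^ s * X g d' ^ s)) := by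
        refine sum_le_sum fun d _ => sum_le_sum fun d' _ =>
          mul_le_mul_of_nonneg_left ?_ (by positivity)
        refine sum_relation_le hs hs1 (hinj d) (hinj d')
          (fun v hv => ha0 v (mem_filter.1 hv).1) (fun w hw => ha0 w (mem_filter.1 hw).1)
          (fun v _ => hF0 f hf v) (fun w _ => hF0 g hg w) ?_
        intro v hv w hw hR
        have hv := (mem_filter.1 hv).1
        have hw := (mem_filter.1 hw).1
        refine ⟨hFle f hf v hv w hw hR.2 hR.1.1, hFle g hg w hw v hv hR.2.symm ?_⟩
        rw [Nat.lcm_comm]; exact hR.1.2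
    _ = C * E ^ 2 * ((∑ d ∈ N.divisors, τ / d * X f d ^ s) *
        ∑ d ∈ N.divisors, τ / d * X g d ^ s) := by
        rw [sum_mul_sum, mul_sum]
        refine sum_congr rfl fun d _ => ?_
        rw [mul_sum]
        refine sum_congr rfl fun d' _ => ?_
        ring
    _ ≤ C * E ^ 2 * (mass H f ^ s * mass H g ^ s) := by
        have h1 := hJ f hf
        have h2 := hJ g hg
        have h3 : 0 ≤ ∑ d ∈ N.divisors, τ / d * X g d ^ s := sum_nonneg fun d _ =>
          mul_nonneg (by positivity) (Real.rpow_nonneg (hX0 g hg d) s)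
        have h4 : 0 ≤ mass H f ^ s := Real.rpow_nonneg (mass_nonneg hf) s
        gcongr

/-! ### The estimate without loss at large primes -/

theorem factorization_prime_pow_mul {p i v : ℕ} (hp : p.Prime) (hv : ¬ p ∣ v) :
    (p ^ i * v).factorization p = i := by
  have hv0 : v ≠ 0 := fun h => hv (h ▸ dvd_zero p)
  rw [Nat.factorization_mul (pow_ne_zero _ hp.ne_zero) hv0, hp.factorization_pow]
  simp [Nat.factorization_eq_zero_of_not_dvd hv]

theorem edgeSum_factorization_le {p m e : ℕ} (hp : p.Prime) (hpm : ¬ p ∣ m) {s B : ℝ}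
    (hs1 : s < 1) (hB : 0 ≤ B) {c : ℕ → ℕ → ℝ} (hc : ∀ i j, 0 ≤ c i j)
    (hb : EdgeBound (fun _ _ => 1) m s B)
    {f g : ℕ → ℝ} (hf : ∀ v, 0 ≤ f v) (hg : ∀ w, 0 ≤ g w) :
    edgeSum (fun v w => c (v.factorization p) (w.factorization p)) (p ^ e * m) f g ≤
      B * ∑ i ∈ range (e + 1), ∑ j ∈ range (e + 1), c i j * ker 1 ((p : ℝ) ^ (-(1 - s))) i j *
        (fiberMass p m i f ^ s * fiberMass p m j g ^ s) := by
  refine edgeSum_prime_pow_mul_le hp hpm hs1 hB hc hb (fun i j v hv w hw => ?_) hf hg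
  rw [factorization_prime_pow_mul hp (fun h => hpm (h.trans (Nat.dvd_of_mem_divisors hv))),
    factorization_prime_pow_mul hp (fun h => hpm (h.trans (Nat.dvd_of_mem_divisors hw))), mul_one]

theorem edgeSum_eq_zero_of_mass {h : ℕ → ℕ → ℝ} {H : ℕ} {f g : ℕ → ℝ} (hf : ∀ v, 0 ≤ f v)
    (hg : ∀ w, 0 ≤ g w) (h0 : mass H f = 0 ∨ mass H g = 0) : edgeSum h H f g = 0 := by
  refine sum_eq_zero fun v hv => sum_eq_zero fun w hw => ?_
  rcases h0 with h0 | h0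
  · rw [(sum_eq_zero_iff_of_nonneg fun v _ => mul_nonneg (hf v) (Nat.cast_nonneg _)).1 h0 v hv]
    simp
  · rw [(sum_eq_zero_iff_of_nonneg fun v _ => mul_nonneg (hg v) (Nat.cast_nonneg _)).1 h0 w hw]
    simp

/-- The conclusion of the concentration lemma for the kernel with parameter `P`. -/
def Concentrates (s P C : ℝ) : Prop :=
  ∀ (n : ℕ) (x y : ℕ → ℝ),
    (∀ i, 0 ≤ x i) → (∀ i, 0 ≤ y i) → ∑ i ∈ range n, x i = 1 → ∑ i ∈ range n, y i = 1 →
    1 < kerSum 1 (P ^ (-(1 - s))) s (range n) (range n) x y →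
    ∃ k, 1 * ∑ i ∈ range n, ∑ j ∈ range n, offKer (P ^ (-(1 - s))) i j * (x i ^ s * y j ^ s)
        ≤ C / P ∧
      kerSum 1 (P ^ (-(1 - s))) s ((range n).erase k) ((range n).erase k) x y
        ≤ C * P ^ (-(2 * s))

/-- Either the normalized kernel sum is at most `1` and removing `p` costs nothing, or concentration
holds; its two conclusions are transferred to edges by taking indicator weights of the valuations.
-/
theorem edgeSum_le_or_concentrated {p m e : ℕ} (hp : p.Prime) (hpm : ¬ p ∣ m) {s B C : ℝ}
    (hs1 : s < 1) (hB : 0 ≤ B) (hb : EdgeBound (fun _ _ => 1) m s B)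
    (hcon : Concentrates s p C)
    {f g : ℕ → ℝ} (hf : ∀ v, 0 ≤ f v) (hg : ∀ w, 0 ≤ g w)
    (hX : 0 < mass (p ^ e * m) f) (hY : 0 < mass (p ^ e * m) g) :
    edgeSum (fun _ _ => 1) (p ^ e * m) f g
        ≤ B * (mass (p ^ e * m) f ^ s * mass (p ^ e * m) g ^ s) ∨
      ∃ k, edgeSum (fun v w => if v.factorization p = w.factorization p then 0 else 1)
          (p ^ e * m) f g
          ≤ B * (mass (p ^ e * m) f ^ s * mass (p ^ e * m) g ^ s) * (C / p) ∧
        edgeSum (fun v w => if v.factorization p = k ∨ w.factorization p = k then 0 else 1)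
          (p ^ e * m) f g
          ≤ B * (mass (p ^ e * m) f ^ s * mass (p ^ e * m) g ^ s) * (C * (p : ℝ) ^ (-(2 * s))) := by
  have hXeq := mass_eq_sum_fiberMass (e := e) hp hpm f
  have hYeq := mass_eq_sum_fiberMass (e := e) hp hpm g
  set X := mass (p ^ e * m) f
  set Y := mass (p ^ e * m) g
  set q := (p : ℝ) ^ (-(1 - s)) with hq
  set x : ℕ → ℝ := fun i => fiberMass p m i f with hx
  set y : ℕ → ℝ := fun i => fiberMass p m i g with hy
  have hx0 : ∀ i, 0 ≤ x i := fun i => fiberMass_nonneg hf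
  have hy0 : ∀ i, 0 ≤ y i := fun i => fiberMass_nonneg hg
  have hZ : 0 < X ^ s * Y ^ s := by positivity
  have hmain : ∀ c : ℕ → ℕ → ℝ, (∀ i j, 0 ≤ c i j) →
      edgeSum (fun v w => c (v.factorization p) (w.factorization p)) (p ^ e * m) f g ≤
      B * ∑ i ∈ range (e + 1), ∑ j ∈ range (e + 1), c i j * ker 1 q i j *
        (x i ^ s * y j ^ s) := fun c hc => edgeSum_factorization_le hp hpm hs1 hB hc hb hf hg
  by_cases hT : kerSum 1 q s (range (e + 1)) (range (e + 1)) (fun i => x i / X)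
      (fun i => y i / Y) ≤ 1
  · left
    have h1 := hmain (fun _ _ => 1) (fun _ _ => zero_le_one)
    simp only [one_mul] at h1
    refine h1.trans (mul_le_mul_of_nonneg_left ?_ hB)
    change kerSum 1 q s _ _ x y ≤ _
    rw [kerSum_eq_normalized hX hY hx0 hy0]
    exact mul_le_of_le_one_right hZ.le hT
  · right
    push Not at hT
    obtain ⟨k, hk1, hk2⟩ := hcon _ _ _ (fun i => div_nonneg (hx0 i) hX.le)
      (fun i => div_nonneg (hy0 i) hY.le)
      (by rw [← sum_div, ← hXeq, div_self hX.ne']) (by rw [← sum_div, ← hYeq, div_self hY.ne']) hT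
    refine ⟨k, ?_, ?_⟩
    · refine (hmain (fun i j => if i = j then 0 else 1)
        (fun i j => by split_ifs <;> norm_num)).trans ?_
      rw [mul_assoc]
      refine mul_le_mul_of_nonneg_left ?_ hB
      refine le_trans (le_of_eq ?_) (mul_le_mul_of_nonneg_left hk1 hZ.le)
      rw [one_mul, mul_sum]
      refine sum_congr rfl fun i _ => ?_
      rw [mul_sum]
      refine sum_congr rfl fun j _ => ?_
      have hXs : X ^ s ≠ 0 := by positivity
      have hYs : Y ^ s ≠ 0 := by positivity
      rw [Real.div_rpow (hx0 i) hX.le, Real.div_rpow (hy0 j) hY.le, ker]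
      split_ifs with hij
      · rw [hij]; simp [offKer]
      · field_simp; ring
    · refine (hmain (fun i j => if i = k ∨ j = k then 0 else 1)
        (fun i j => by split_ifs <;> norm_num)).trans ?_
      rw [mul_assoc]
      refine mul_le_mul_of_nonneg_left ?_ hB
      refine le_trans (le_of_eq ?_) (mul_le_mul_of_nonneg_left hk2 hZ.le)
      rw [← kerSum_eq_normalized hX hY hx0 hy0, kerSum]
      have hsub : (range (e + 1)).erase k ⊆ range (e + 1) := erase_subset _ _
      have hnot : ∀ i ∈ range (e + 1), i ∉ (range (e + 1)).erase k → i = k := fun i hi hn => by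
        by_contra h; exact hn (mem_erase.2 ⟨h, hi⟩)
      rw [← sum_subset hsub]
      · refine sum_congr rfl fun i hi => ?_
        rw [← sum_subset hsub]
        · refine sum_congr rfl fun j hj => ?_
          rw [if_neg (by simp [ne_of_mem_erase hi, ne_of_mem_erase hj]), one_mul]
        · intro j hj hn
          rw [if_pos (Or.inr (hnot j hj hn))]; ring
      · intro i hi hn
        refine sum_eq_zero fun j _ => ?_
        rw [if_pos (Or.inl (hnot i hi hn))]; ring

theorem exists_tail_sum_le {a : ℕ → ℝ} (ha : Summable a) {δ : ℝ} (hδ : 0 < δ) :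
    ∃ n₀ : ℕ, ∀ S : Finset ℕ, (∀ p ∈ S, n₀ ≤ p) → ∑ p ∈ S, a p ≤ δ := by
  obtain ⟨T, hT⟩ := summable_iff_vanishing_norm.1 ha δ hδ
  refine ⟨T.sup id + 1, fun S hS => ?_⟩
  refine (le_abs_self _).trans (hT S ?_).le
  rw [disjoint_left]
  intro p hp hpT
  have h1 := hS p hp
  have h2 : p ≤ T.sup id := le_sup (f := id) hpT
  omega

theorem exists_nat_factorization_eq (S : Finset ℕ) (hS : ∀ p ∈ S, p.Prime) (k : ℕ → ℕ) :
    ∃ N : ℕ, N ≠ 0 ∧ N.primeFactors ⊆ S ∧ ∀ p ∈ S, N.factorization p = k p := by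
  classical
  set F : ℕ →₀ ℕ := Finsupp.onFinset S (fun p => if p ∈ S then k p else 0)
    (fun p hp => by by_contra h; simp [h] at hp) with hF
  have hFS : F.support ⊆ S := Finsupp.support_onFinset_subset
  have hfac := Nat.prod_pow_factorization_eq_self (f := F) (fun p hp => hS p (hFS hp))
  refine ⟨F.prod (· ^ ·), ?_, ?_, fun p hp => ?_⟩
  · exact prod_ne_zero_iff.2 fun p hp => pow_ne_zero _ (hS p (hFS hp)).ne_zero
  · rw [← Nat.support_factorization, hfac]; exact hFS
  · rw [hfac, hF]; simp [hp]

/-- The main estimate for integers without small prime factors. -/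
theorem exists_edgeBound_rough {s : ℝ} (hs : 1 / 2 < s) (hs1 : s < 1) :
    ∃ (p₀ : ℕ) (B : ℝ), 0 < B ∧ ∀ H : ℕ, H ≠ 0 → (∀ p ∈ H.primeFactors, p₀ ≤ p) →
      EdgeBound (fun _ _ => 1) H s B := by
  classical
  obtain ⟨P₁, C, hP₁, hC, hcon⟩ := exists_concentration_of_one_lt_kerSum hs hs1 le_rfl
  obtain ⟨n₁, hn₁⟩ : ∃ n₀ : ℕ, ∀ S : Finset ℕ, (∀ p ∈ S, n₀ ≤ p) →
      ∑ p ∈ S, C * (p : ℝ) ^ (-(2 * s)) ≤ 1 / 4 :=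
    exists_tail_sum_le ((Real.summable_nat_rpow.2 (by linarith)).mul_left C) (by norm_num)
  obtain ⟨n₂, hn₂⟩ : ∃ n₀ : ℕ, ∀ S : Finset ℕ, (∀ p ∈ S, n₀ ≤ p) →
      ∑ p ∈ S, C * (p : ℝ) ^ (-2 : ℝ) ≤ 1 / 4 :=
    exists_tail_sum_le ((Real.summable_nat_rpow.2 (by norm_num)).mul_left C) (by norm_num)
  set C₀ : ℝ := 4 / (1 - 4 ^ (-(1 - s))) * Real.exp 2 ^ 2 with hC₀
  have hC₀0 : 0 < C₀ := by
    have : (4 : ℝ) ^ (-(1 - s)) < 1 :=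
      Real.rpow_lt_one_of_one_lt_of_neg (by norm_num) (by linarith)
    have : 0 < 1 - (4 : ℝ) ^ (-(1 - s)) := by linarith
    positivity
  -- The constant `B = 2 * C₀` solves `B = C₀ + B/4 + B/4`: near pairs, then the two exceptional
  -- families of edges.
  refine ⟨max ⌈P₁⌉₊ (max n₁ n₂), 2 * C₀, by positivity, ?_⟩
  intro H
  induction H using Nat.strong_induction_on with
  | _ H ih =>
  intro hH hrough f g hf hg
  set B := 2 * C₀ with hB
  have hB0 : 0 ≤ B := by positivity
  rcases (mass_nonneg hf).eq_or_lt with hX | hX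
  · rw [edgeSum_eq_zero_of_mass hf hg (Or.inl hX.symm)]
    have := mass_nonneg (H := H) hf
    have := mass_nonneg (H := H) hg
    positivity
  rcases (mass_nonneg hg).eq_or_lt with hY | hY
  · rw [edgeSum_eq_zero_of_mass hf hg (Or.inr hY.symm)]
    have := mass_nonneg (H := H) hf
    have := mass_nonneg (H := H) hg
    positivity
  set Z := mass H f ^ s * mass H g ^ s with hZ
  have hZ0 : 0 < Z := by positivity
  have hstep : ∀ p ∈ H.primeFactors, edgeSum (fun _ _ => 1) H f g ≤ B * Z ∨
      ∃ k, edgeSum (fun v w => if v.factorization p = w.factorization p then 0 else 1) H f g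
          ≤ B * Z * (C / p) ∧
        edgeSum (fun v w => if v.factorization p = k ∨ w.factorization p = k then 0 else 1) H f g
          ≤ B * Z * (C * (p : ℝ) ^ (-(2 * s))) := by
    intro p hpH
    have hp := Nat.prime_of_mem_primeFactors hpH
    have hHp := Nat.ordProj_mul_ordCompl_eq_self H p
    have hpm := Nat.not_dvd_ordCompl hp hH
    have hm0 : ordCompl[p] H ≠ 0 := fun h => hpm (h ▸ dvd_zero p)
    have hlt : ordCompl[p] H < H := by
      refine lt_of_le_of_ne (Nat.ordCompl_le H p) fun h => hpm ?_
      rw [h]; exact Nat.dvd_of_mem_primeFactors hpH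
    have hb := ih _ hlt hm0 fun r hr => hrough r
      (Nat.primeFactors_mono (Nat.ordCompl_dvd H p) hH hr)
    have hPp : P₁ ≤ p := (Nat.le_ceil P₁).trans
      (Nat.cast_le.2 ((le_max_left _ _).trans (hrough p hpH)))
    have := edgeSum_le_or_concentrated (e := H.factorization p) hp hpm hs1 hB0 hb
      (hcon p hPp) hf hg (by rwa [hHp]) (by rwa [hHp])
    rwa [hHp] at this
  by_cases hex : ∃ p ∈ H.primeFactors, edgeSum (fun _ _ => 1) H f g ≤ B * Z
  · exact hex.choose_spec.2
  have hk : ∀ p, ∃ k, p ∈ H.primeFactors →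
      edgeSum (fun v w => if v.factorization p = w.factorization p then 0 else 1) H f g
          ≤ B * Z * (C / p) ∧
        edgeSum (fun v w => if v.factorization p = k ∨ w.factorization p = k then 0 else 1) H f g
          ≤ B * Z * (C * (p : ℝ) ^ (-(2 * s))) := by
    intro p
    by_cases hpH : p ∈ H.primeFactors
    · obtain ⟨k, hk⟩ := (hstep p hpH).resolve_left fun h => hex ⟨p, hpH, h⟩
      exact ⟨k, fun _ => hk⟩
    · exact ⟨0, fun h => absurd h hpH⟩
  choose k hk using hk
  obtain ⟨N, hN, hNH, hNk⟩ := exists_nat_factorization_eq H.primeFactors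
    (fun p hp => Nat.prime_of_mem_primeFactors hp) k
  -- A pair that is not near either misses `k p` at both ends for some prime (union bound) or has
  -- disagreements with `∑ 1/p > 1` (Markov's inequality).
  have hpt : ∀ v w : ℕ, (1 : ℝ) ≤ ((if NearPair H N v w then 1 else 0) +
      ∑ p ∈ H.primeFactors,
        (if v.factorization p = k p ∨ w.factorization p = k p then 0 else 1)) +
      ∑ p ∈ H.primeFactors,
        (p : ℝ)⁻¹ * (if v.factorization p = w.factorization p then 0 else 1) := by
    intro v w
    have h1 : (0 : ℝ) ≤ ∑ p ∈ H.primeFactors,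
        (if v.factorization p = k p ∨ w.factorization p = k p then 0 else 1) :=
      sum_nonneg fun p _ => by split_ifs <;> norm_num
    have h2 : (0 : ℝ) ≤ ∑ p ∈ H.primeFactors,
        (p : ℝ)⁻¹ * (if v.factorization p = w.factorization p then 0 else 1) :=
      sum_nonneg fun p _ => by split_ifs <;> positivity
    by_cases hnear : NearPair H N v w
    · rw [if_pos hnear]; linarith
    rw [if_neg hnear, zero_add]
    by_cases h3 : ∀ p ∈ H.primeFactors, v.factorization p = N.factorization p ∨
        w.factorization p = N.factorization p
    · have h4 : 1 < ∑ p ∈ H.primeFactors with v.factorization p ≠ w.factorization p, (p : ℝ)⁻¹ := by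
        by_contra h; exact hnear ⟨h3, not_lt.1 h⟩
      rw [sum_filter] at h4
      have h5 : ∑ p ∈ H.primeFactors, (if v.factorization p ≠ w.factorization p then
          (p : ℝ)⁻¹ else 0) = ∑ p ∈ H.primeFactors,
          (p : ℝ)⁻¹ * (if v.factorization p = w.factorization p then 0 else 1) :=
        sum_congr rfl fun p _ => by split_ifs <;> simp_all
      linarith
    · push Not at h3
      obtain ⟨p, hp, h4, h5⟩ := h3
      have h6 := single_le_sum (f := fun p => if v.factorization p = k p ∨ w.factorization p = k p
        then (0 : ℝ) else 1) (fun p _ => by split_ifs <;> norm_num) hp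
      rw [hNk p hp] at h4 h5
      simp only [h4, h5, or_self, if_false] at h6
      linarith
  have hnear := edgeSum_nearPair_le hs hs1 hN hNH f g hf hg
  have hb1 : ∑ p ∈ H.primeFactors, B * Z * (C * (p : ℝ) ^ (-(2 * s))) ≤ B * Z * (1 / 4) := by
    rw [← mul_sum]
    exact mul_le_mul_of_nonneg_left (hn₁ _ fun p hp =>
      (le_max_left _ _).trans ((le_max_right _ _).trans (hrough p hp))) (by positivity)
  -- The Markov weight `1/p` times the disagreement proportion `C/p` gives a convergent series.
  have hb2 : ∑ p ∈ H.primeFactors, (p : ℝ)⁻¹ * (B * Z * (C / p)) ≤ B * Z * (1 / 4) := by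
    have : ∀ p : ℕ, (p : ℝ)⁻¹ * (B * Z * (C / p)) = B * Z * (C * (p : ℝ) ^ (-2 : ℝ)) := by
      intro p
      rw [Real.rpow_neg (Nat.cast_nonneg p), Real.rpow_two]
      ring
    simp_rw [this]
    rw [← mul_sum]
    exact mul_le_mul_of_nonneg_left (hn₂ _ fun p hp =>
      (le_max_right _ _).trans ((le_max_right _ _).trans (hrough p hp))) (by positivity)
  calc edgeSum (fun _ _ => 1) H f g ≤ _ := edgeSum_mono hf hg fun v _ w _ => hpt v w
    _ ≤ C₀ * Z + B * Z * (1 / 4) + B * Z * (1 / 4) := by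
      rw [edgeSum_add, edgeSum_add, edgeSum_sum, edgeSum_sum]
      refine add_le_add (add_le_add hnear ?_) ?_
      · exact (sum_le_sum fun p hp => (hk p hp).2).trans hb1
      · refine (sum_le_sum fun p hp => ?_).trans hb2
        rw [edgeSum_mul]
        exact mul_le_mul_of_nonneg_left (hk p hp).1 (by positivity)
    _ = B * Z := by rw [hB]; ring

/-! ### The weighted estimate, with a loss at the primes of `S` -/

theorem card_filter_insert_prime_pow_mul_le {p : ℕ} (hp : p.Prime) {S : Finset ℕ} (hpS : p ∉ S)
    (i j : ℕ) {v w : ℕ} (hv : ¬ p ∣ v) (hw : ¬ p ∣ w) :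
    ((insert p S).filter fun r => (p ^ i * v).factorization r ≠ (p ^ j * w).factorization r).card ≤
      (if i = j then 0 else 1) +
        (S.filter fun r => v.factorization r ≠ w.factorization r).card := by
  have hfac : ∀ k u, ¬ p ∣ u → ∀ r ∈ S, (p ^ k * u).factorization r = u.factorization r := by
    intro k u hu r hr
    have hu0 : u ≠ 0 := fun h => hu (h ▸ dvd_zero p)
    have hrp : p ≠ r := fun h => hpS (h ▸ hr)
    rw [Nat.factorization_mul (pow_ne_zero _ hp.ne_zero) hu0, hp.factorization_pow]
    simp [hrp]
  have hS : (S.filter fun r => (p ^ i * v).factorization r ≠ (p ^ j * w).factorization r) =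
      S.filter fun r => v.factorization r ≠ w.factorization r :=
    filter_congr fun r hr => by rw [hfac i v hv r hr, hfac j w hw r hr]
  rw [filter_insert, factorization_prime_pow_mul hp hv, factorization_prime_pow_mul hp hw, hS]
  by_cases h : i = j
  · rw [if_neg (not_not.2 h), if_pos h, zero_add]
  · rw [if_pos h, if_neg h, add_comm]; exact card_insert_le _ _

/-- Induction on `S` from the estimate for large primes. Each prime of `S` multiplies off-diagonal
entries of the kernel by `A`, and `exists_kerSum_le` holds for that kernel with loss `1 + C/p`. -/
theorem exists_edgeBound_weighted {s A : ℝ} (hs : 1 / 2 < s) (hs1 : s < 1) (hA : 1 ≤ A) :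
    ∃ (p₀ : ℕ) (B C : ℝ), 0 < B ∧ 0 < C ∧ ∀ S : Finset ℕ, (∀ p ∈ S, p.Prime) →
      ∀ H : ℕ, H ≠ 0 → (∀ p ∈ H.primeFactors, p ∉ S → p₀ ≤ p) →
      EdgeBound (fun v w => A ^ (S.filter fun p => v.factorization p ≠ w.factorization p).card) H s
        (B * ∏ p ∈ S, (1 + C / p)) := by
  obtain ⟨p₀, B, hB, hcore⟩ := exists_edgeBound_rough hs hs1
  obtain ⟨C, hC, hker⟩ := exists_kerSum_le hs hs1 hA
  refine ⟨p₀, B, C, hB, hC, fun S => ?_⟩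
  induction S using Finset.induction_on with
  | empty =>
    intro _ H hH hr
    simpa using hcore H hH fun p hp => hr p hp (notMem_empty p)
  | insert p S hpS ih =>
    intro hS H hH hr f g hf hg
    have hp := hS p (mem_insert_self p S)
    have hprod0 : 0 < ∏ p ∈ S, (1 + C / p) := prod_pos fun r _ => by positivity
    rcases (mass_nonneg hf).eq_or_lt with hX | hX
    · rw [edgeSum_eq_zero_of_mass hf hg (Or.inl hX.symm), ← hX, Real.zero_rpow (by linarith)]
      simp
    rcases (mass_nonneg hg).eq_or_lt with hY | hY
    · rw [edgeSum_eq_zero_of_mass hf hg (Or.inr hY.symm), ← hY, Real.zero_rpow (by linarith)]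
      simp
    have hHp := Nat.ordProj_mul_ordCompl_eq_self H p
    have hpm := Nat.not_dvd_ordCompl hp hH
    set e := H.factorization p
    set m := ordCompl[p] H with hm
    have hm0 : m ≠ 0 := fun h => hpm (h ▸ dvd_zero p)
    have hb := ih (fun r hr => hS r (mem_insert_of_mem hr)) m hm0 (fun r hrm hrS => by
      refine hr r (Nat.primeFactors_mono (Nat.ordCompl_dvd H p) hH hrm) fun h => ?_
      rcases mem_insert.1 h with h | h
      · exact hpm (h ▸ Nat.dvd_of_mem_primeFactors hrm)
      · exact hrS h)
    have h1 := edgeSum_prime_pow_mul_le (e := e) hp hpm hs1 (by positivity)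
      (h := fun v w =>
        A ^ ((insert p S).filter fun r => v.factorization r ≠ w.factorization r).card)
      (c := fun i j => if i = j then 1 else A) (fun i j => by split_ifs <;> linarith)
      hb (fun i j v hv w hw => by
        have hle := card_filter_insert_prime_pow_mul_le hp hpS i j
          (fun h => hpm (h.trans (Nat.dvd_of_mem_divisors hv)))
          (fun h => hpm (h.trans (Nat.dvd_of_mem_divisors hw)))
        refine (pow_le_pow_right₀ hA hle).trans_eq ?_
        rw [pow_add]
        split_ifs <;> simp) hf hg
    rw [hHp] at h1
    refine h1.trans ?_
    have hXeq := mass_eq_sum_fiberMass (e := e) hp hpm f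
    have hYeq := mass_eq_sum_fiberMass (e := e) hp hpm g
    rw [hHp] at hXeq hYeq
    set X := mass H f
    set Y := mass H g
    have hx0 : ∀ i, 0 ≤ fiberMass p m i f := fun i => fiberMass_nonneg hf
    have hy0 : ∀ i, 0 ≤ fiberMass p m i g := fun i => fiberMass_nonneg hg
    have h2 := hker p (by exact_mod_cast hp.two_le) (e + 1) _ _
      (fun i => div_nonneg (hx0 i) hX.le) (fun i => div_nonneg (hy0 i) hY.le)
      (by rw [← sum_div, ← hXeq, div_self hX.ne']) (by rw [← sum_div, ← hYeq, div_self hY.ne'])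
    have hcker : ∀ i j, (if i = j then 1 else A) * ker 1 ((p : ℝ) ^ (-(1 - s))) i j =
        ker A ((p : ℝ) ^ (-(1 - s))) i j := by
      intro i j
      rw [ker, ker]
      split_ifs with h
      · rw [h, offKer_self]; ring
      · ring
    simp_rw [hcker]
    change _ * kerSum A _ s _ _ (fun i => fiberMass p m i f) (fun i => fiberMass p m i g) ≤ _
    rw [kerSum_eq_normalized hX hY hx0 hy0, prod_insert hpS]
    calc _ ≤ B * (∏ r ∈ S, (1 + C / r)) * (X ^ s * Y ^ s * (1 + C / p)) := by gcongr
      _ = _ := by ring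

/-! ### Reciprocals of primes -/

/-- Chebyshev's bound for `θ(2^(k+1))`, with each prime of the block having `p ≥ 2^k` and `log p ≥ k
log 2`. -/
theorem sum_inv_prime_dyadic_le {k : ℕ} (hk : 1 ≤ k) :
    ∑ p ∈ Ioc ((2 : ℕ) ^ k) (2 ^ (k + 1)) with p.Prime, (p : ℝ)⁻¹ ≤ 4 / k := by
  have hk0 : (0 : ℝ) < k := by exact_mod_cast hk
  have hl2 : 0 < Real.log 2 := Real.log_pos (by norm_num)
  have hθ := Chebyshev.theta_le_log4_mul_x (x := ((2 ^ (k + 1) : ℕ) : ℝ)) (by positivity)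
  rw [Chebyshev.theta, Nat.floor_natCast] at hθ
  have h4 : Real.log 4 = 2 * Real.log 2 := by
    rw [show (4 : ℝ) = 2 ^ 2 by norm_num, Real.log_pow]; norm_num
  calc _ ≤ ∑ p ∈ Ioc ((2 : ℕ) ^ k) (2 ^ (k + 1)) with p.Prime,
        Real.log p / (k * Real.log 2 * 2 ^ k) := by
        refine sum_le_sum fun p hp => ?_
        obtain ⟨hp, -⟩ := mem_filter.1 hp
        have h2 : (2 : ℝ) ^ k ≤ p := by exact_mod_cast (mem_Ioc.1 hp).1.le
        have hp0 : (0 : ℝ) < p := lt_of_lt_of_le (by positivity) h2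
        have h3 : k * Real.log 2 ≤ Real.log p := by
          rw [← Real.log_pow]; exact Real.log_le_log (by positivity) h2
        rw [inv_eq_one_div, div_le_div_iff₀ hp0 (by positivity), one_mul]
        exact mul_le_mul h3 h2 (by positivity) (by positivity)
    _ ≤ ∑ p ∈ Ioc 0 ((2 : ℕ) ^ (k + 1)) with p.Prime, Real.log p / (k * Real.log 2 * 2 ^ k) := by
        refine sum_le_sum_of_subset_of_nonneg
          (filter_subset_filter _ (Ioc_subset_Ioc_left (Nat.zero_le _))) fun p _ _ => ?_
        have := Real.log_natCast_nonneg p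
        positivity
    _ ≤ Real.log 4 * (2 ^ (k + 1) : ℕ) / (k * Real.log 2 * 2 ^ k) := by
        rw [← sum_div]; gcongr
    _ = 4 / k := by
        rw [h4]; push_cast; field_simp; ring

/-- The sum of `1 / p` over the primes `p ≤ t` is `o (log t)`. -/
theorem exists_sum_inv_prime_le {η : ℝ} (hη : 0 < η) :
    ∃ c : ℝ, 0 ≤ c ∧ ∀ t : ℝ, 1 ≤ t →
      ∑ p ∈ Icc 1 ⌊t⌋₊ with p.Prime, (p : ℝ)⁻¹ ≤ η * Real.log t + c := by
  have hl2 : 0 < Real.log 2 := Real.log_pos (by norm_num)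
  -- From the block `k₀` on, each dyadic block contributes at most `η log 2`, while about `log t /
  -- log 2` blocks occur.
  set k₀ : ℕ := ⌈4 / (η * Real.log 2)⌉₊ + 1 with hk₀
  have hk₀le : ∀ k : ℕ, k₀ ≤ k → 4 / (k : ℝ) ≤ η * Real.log 2 := by
    intro k hk
    have h1 : 4 / (η * Real.log 2) ≤ k :=
      (Nat.le_ceil _).trans (by exact_mod_cast (by omega : ⌈4 / (η * Real.log 2)⌉₊ ≤ k))
    have hk0 : (0 : ℝ) < k := by exact_mod_cast (by omega : 0 < k)
    rw [div_le_iff₀ (by positivity)] at h1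
    rw [div_le_iff₀ hk0]; linarith
  set σ : ℕ → ℝ := fun n => ∑ p ∈ Ioc 0 n with p.Prime, (p : ℝ)⁻¹ with hσ
  have hmono : ∀ m n, m ≤ n → σ m ≤ σ n := fun m n h =>
    sum_le_sum_of_subset_of_nonneg (filter_subset_filter _ (Ioc_subset_Ioc_right h))
      fun _ _ _ => by positivity
  have hσ0 : ∀ n, 0 ≤ σ n := fun n => sum_nonneg fun _ _ => by positivity
  have hK : ∀ K, k₀ ≤ K → σ (2 ^ K) ≤ σ (2 ^ k₀) + η * Real.log 2 * K := by
    intro K hK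
    induction K, hK using Nat.le_induction with
    | base => exact le_add_of_nonneg_right (by positivity)
    | succ K hK ih =>
      have h1 : σ (2 ^ (K + 1)) = σ (2 ^ K) +
          ∑ p ∈ Ioc ((2 : ℕ) ^ K) (2 ^ (K + 1)) with p.Prime, (p : ℝ)⁻¹ := by
        rw [hσ]
        simp only [sum_filter]
        rw [← sum_Ioc_consecutive _ (Nat.zero_le _) (Nat.pow_le_pow_right two_pos (Nat.le_succ K))]
      have h2 := sum_inv_prime_dyadic_le (k := K) (by omega)
      have h3 := hk₀le K hK
      rw [h1]; push_cast; linarith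
  refine ⟨σ (2 ^ k₀) + η * Real.log 2, add_nonneg (hσ0 _) (by positivity), fun t ht => ?_⟩
  have hn : ⌊t⌋₊ ≠ 0 := (Nat.floor_pos.2 ht).ne'
  set L := Nat.log 2 ⌊t⌋₊ with hL
  have hL1 : ⌊t⌋₊ ≤ 2 ^ (L + 1) := (Nat.lt_pow_succ_log_self (by norm_num) _).le
  have hL2 : (L : ℝ) * Real.log 2 ≤ Real.log t := by
    rw [← Real.log_pow]
    refine Real.log_le_log (by positivity) (le_trans ?_ (Nat.floor_le (by linarith)))
    exact_mod_cast Nat.pow_log_le_self 2 hn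
  have hlt : 0 ≤ Real.log t := Real.log_nonneg ht
  change σ ⌊t⌋₊ ≤ _
  rcases le_total k₀ (L + 1) with h | h
  · have h1 := (hmono _ _ hL1).trans (hK _ h)
    push_cast at h1
    have := mul_le_mul_of_nonneg_left hL2 hη.le
    linarith
  · have h1 := hmono _ _ (hL1.trans (Nat.pow_le_pow_right two_pos h))
    have : 0 ≤ η * Real.log t := by positivity
    have : 0 ≤ η * Real.log 2 := by positivity
    linarith

/-! ### Deduction of the theorem -/

theorem factorization_ne_of_dvd {p v w : ℕ} (hp : p.Prime) (hv : v ≠ 0) (hw : w ≠ 0)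
    (h : p ∣ v * w / Nat.gcd v w ^ 2) : v.factorization p ≠ w.factorization p := by
  intro he
  have hd : Nat.gcd v w ^ 2 ∣ v * w := by
    rw [sq]; exact mul_dvd_mul (Nat.gcd_dvd_left _ _) (Nat.gcd_dvd_right _ _)
  have hne : v * w / Nat.gcd v w ^ 2 ≠ 0 :=
    (Nat.div_pos (Nat.le_of_dvd (by positivity) hd)
      (pow_pos (Nat.gcd_pos_of_pos_left _ (Nat.pos_of_ne_zero hv)) 2)).ne'
  have h1 := hp.factorization_pos_of_dvd hne h
  rw [Nat.factorization_div hd, Nat.factorization_mul hv hw, Nat.factorization_pow,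
    Nat.factorization_gcd hv hw] at h1
  simp only [Finsupp.tsub_apply, Finsupp.add_apply, Finsupp.smul_apply, Finsupp.inf_apply,
    smul_eq_mul, he] at h1
  omega

theorem isEdge_of_bigD_le {ψ : ℕ → ℝ≥0} {y : ℝ} (hy : 0 < y) {v w : ℕ} (hv : v ≠ 0) (hw : w ≠ 0)
    {f : ℕ → ℝ} (hfv : f v = ψ v / (v * y)) (hfw : f w = ψ w / (w * y))
    (h : bigD ψ ψ v w ≤ y) : IsEdge f f v w := by
  have hg : (0 : ℝ) < Nat.gcd v w := Nat.cast_pos.2 (Nat.gcd_pos_of_pos_left _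
    (Nat.pos_of_ne_zero hv))
  have hv0 : (0 : ℝ) < v := by positivity
  have hw0 : (0 : ℝ) < w := by positivity
  rw [bigD, div_le_iff₀ hg, max_le_iff] at h
  have hl : (Nat.lcm v w : ℝ) = v * w / Nat.gcd v w := by
    rw [eq_div_iff hg.ne', mul_comm]; exact_mod_cast Nat.gcd_mul_lcm v w
  constructor
  · rw [hl, hfv, div_mul_div_comm, div_le_one (by positivity)]
    nlinarith [mul_le_mul_of_nonneg_left h.1 hv0.le]
  · rw [hl, hfw, div_mul_div_comm, div_le_one (by positivity)]
    nlinarith [mul_le_mul_of_nonneg_left h.2 hw0.le]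

theorem prod_one_add_div_le_exp {C : ℝ} (hC : 0 ≤ C) (S : Finset ℕ) :
    ∏ p ∈ S, (1 + C / p) ≤ Real.exp (C * ∑ p ∈ S, (p : ℝ)⁻¹) := by
  rw [mul_sum, Real.exp_sum]
  refine prod_le_prod (fun p _ => by positivity) fun p _ => ?_
  rw [add_comm, div_eq_mul_inv]
  exact Real.add_one_le_exp _

theorem mainTheorem3 (ε κ C : ℝ) (hε : 0 < ε) (hε' : ε ≤ 4 / 5) (hκ : 0 < κ) (hC : 1 ≤ C) :
    ∃ M : ℝ, 0 < M ∧ ∀ (ψ : ℕ → ℝ≥0) (y t : ℝ) (Q : ℕ), 1 ≤ y → 1 ≤ t →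
      ∑ x ∈ anatomyPairs ψ κ y t Q,
          ((ψ x.1 : ℝ) * (Nat.totient x.1 : ℝ) / (x.1 : ℝ)) *
            ((ψ x.2 : ℝ) * (Nat.totient x.2 : ℝ) / (x.2 : ℝ))
        ≤ M * t ^ (-C) * y ^ (1 - ε) * bigPsi ψ Q ^ (1 + ε) := by
  classical
  set s : ℝ := (1 + ε) / 2 with hs
  -- Chosen so that `A ^ (κ log t) = t ^ (C + 1)`; the extra `1` pays for the product over primes.
  set A : ℝ := Real.exp ((C + 1) / κ) with hA
  have hA1 : 1 ≤ A := Real.one_le_exp (by positivity)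
  obtain ⟨p₀, B, K, hB, hK, hbound⟩ := exists_edgeBound_weighted (s := s) (A := A)
    (by linarith) (by linarith) hA1
  -- With `η = 1/K` the product of `1 + K/p` over `p ≤ t` is `O(t)`.
  obtain ⟨c, hc, hprimes⟩ := exists_sum_inv_prime_le (η := 1 / K) (by positivity)
  refine ⟨B * Real.exp (K * (c + p₀)), by positivity, ?_⟩
  intro ψ y t Q hy ht
  have hy0 : 0 < y := by linarith
  have ht0 : 0 < t := by linarith
  -- The primes below `p₀` are added so that every prime outside `S` is large; they cost a constant
  -- factor only.
  set S : Finset ℕ := ((Icc 1 ⌊t⌋₊).filter Nat.Prime) ∪ ((range p₀).filter Nat.Prime) with hS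
  have hSp : ∀ p ∈ S, p.Prime := fun p hp => by
    rcases mem_union.1 hp with h | h <;> exact (mem_filter.1 h).2
  set f : ℕ → ℝ := fun v => if v ∈ Icc 1 Q then ψ v / (v * y) else 0 with hf
  have hf0 : ∀ v, 0 ≤ f v := fun v => by rw [hf]; dsimp only; split_ifs <;> positivity
  -- Any common multiple of `1, …, Q` would serve; `f` vanishes at its other divisors.
  set H : ℕ := Nat.factorial Q with hH
  have hH0 : H ≠ 0 := Nat.factorial_ne_zero Q
  have hsub : Icc 1 Q ⊆ H.divisors := fun v hv =>
    Nat.mem_divisors.2 ⟨Nat.dvd_factorial (mem_Icc.1 hv).1 (mem_Icc.1 hv).2, hH0⟩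
  have hfeq : ∀ v ∈ Icc 1 Q, f v = ψ v / (v * y) := fun v hv => if_pos hv
  have hμ : ∀ v ∈ Icc 1 Q, (ψ v : ℝ) * Nat.totient v / v = y * (f v * Nat.totient v) :=
    fun v hv => by
      have : (v : ℝ) ≠ 0 := Nat.cast_ne_zero.2 (by have := (mem_Icc.1 hv).1; omega)
      rw [hfeq v hv]; field_simp
  have hmass : mass H f = bigPsi ψ Q / (2 * y) := by
    rw [mass, bigPsi, sum_div, ← sum_subset hsub]
    · refine sum_congr rfl fun v hv => ?_
      have : (v : ℝ) ≠ 0 := Nat.cast_ne_zero.2 (by have := (mem_Icc.1 hv).1; omega)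
      rw [hfeq v hv]; field_simp
    · intro v _ hv
      rw [hf]; simp only [if_neg hv, zero_mul]
  have hΨ0 : 0 ≤ bigPsi ψ Q := sum_nonneg fun q _ => by positivity
  set N : ℕ → ℕ → ℕ := fun v w => (S.filter fun p => v.factorization p ≠ w.factorization p).card
  have hN : ∀ v w, v ≠ 0 → w ≠ 0 → κ * Real.log t ≤ omegaT t v w →
      1 ≤ t ^ (-(C + 1)) * A ^ N v w := by
    intro v w hv hw h
    have hle : omegaT t v w ≤ N v w := by
      refine card_le_card fun p hp => ?_
      obtain ⟨h1, h2, h3⟩ := mem_filter.1 hp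
      exact mem_filter.2 ⟨mem_union_left _ (mem_filter.2 ⟨h1, h2⟩),
        factorization_ne_of_dvd h2 hv hw h3⟩
    have h2 : κ * Real.log t ≤ N v w := h.trans (by exact_mod_cast hle)
    rw [Real.rpow_def_of_pos ht0, hA, ← Real.exp_nat_mul, ← Real.exp_add]
    refine Real.one_le_exp ?_
    have h3 : (C + 1) / κ * (κ * Real.log t) ≤ (C + 1) / κ * N v w := by gcongr
    have h4 : (C + 1) / κ * (κ * Real.log t) = (C + 1) * Real.log t := by field_simp
    linarith
  have hsumS : K * ∑ p ∈ S, (p : ℝ)⁻¹ ≤ Real.log t + K * (c + p₀) := by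
    have h1 : ∑ p ∈ S, (p : ℝ)⁻¹ ≤ (1 / K * Real.log t + c) + p₀ := by
      have hui := sum_union_inter (s₁ := (Icc 1 ⌊t⌋₊).filter Nat.Prime)
        (s₂ := (range p₀).filter Nat.Prime) (f := fun p : ℕ => (p : ℝ)⁻¹)
      have hinter : 0 ≤ ∑ p ∈ (Icc 1 ⌊t⌋₊).filter Nat.Prime ∩ (range p₀).filter Nat.Prime,
          (p : ℝ)⁻¹ := sum_nonneg fun _ _ => by positivity
      refine (by linarith : ∑ p ∈ S, (p : ℝ)⁻¹ ≤ ∑ p ∈ (Icc 1 ⌊t⌋₊).filter Nat.Prime, (p : ℝ)⁻¹ +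
        ∑ p ∈ (range p₀).filter Nat.Prime, (p : ℝ)⁻¹).trans (add_le_add (hprimes t ht) ?_)
      calc ∑ p ∈ range p₀ with p.Prime, (p : ℝ)⁻¹ ≤ ∑ p ∈ range p₀ with p.Prime, (1 : ℝ) :=
            sum_le_sum fun p hp => by linarith [inv_prime_le_half (mem_filter.1 hp).2]
        _ = ((range p₀).filter Nat.Prime).card := by simp
        _ ≤ p₀ := by exact_mod_cast (card_filter_le _ _).trans_eq (card_range p₀)
    calc _ ≤ K * ((1 / K * Real.log t + c) + p₀) := by gcongr
      _ = _ := by field_simp; ring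
  have hprod : ∏ p ∈ S, (1 + K / p) ≤ t * Real.exp (K * (c + p₀)) := by
    refine (prod_one_add_div_le_exp hK.le S).trans ((Real.exp_le_exp.2 hsumS).trans_eq ?_)
    rw [Real.exp_add, Real.exp_log ht0]
  have hE := hbound S hSp H hH0 (fun p hp hpS => by
    by_contra! h
    exact hpS (mem_union_right _ (mem_filter.2
      ⟨mem_range.2 h, Nat.prime_of_mem_primeFactors hp⟩))) f f hf0 hf0
  have hterm : ∀ v w, 0 ≤ (if IsEdge f f v w then
      A ^ N v w * ((f v * Nat.totient v) * (f w * Nat.totient w)) else 0 : ℝ) := fun v w => by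
    have := hf0 v
    have := hf0 w
    split_ifs <;> positivity
  have hsum : ∑ x ∈ anatomyPairs ψ κ y t Q,
      ((ψ x.1 : ℝ) * (Nat.totient x.1 : ℝ) / (x.1 : ℝ)) *
        ((ψ x.2 : ℝ) * (Nat.totient x.2 : ℝ) / (x.2 : ℝ)) ≤
      y ^ 2 * t ^ (-(C + 1)) * edgeSum (fun v w => A ^ N v w) H f f := by
    rw [edgeSum, ← sum_product', mul_sum]
    refine le_trans (sum_le_sum fun x hx => ?_) (sum_le_sum_of_subset_of_nonneg
      (s := anatomyPairs ψ κ y t Q) (fun x hx => ?_) (fun x _ _ =>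
        mul_nonneg (by positivity) (hterm x.1 x.2)))
    · obtain ⟨hx1, hD, hω⟩ := mem_filter.1 hx
      obtain ⟨hv, hw⟩ := mem_product.1 hx1
      have hv0 : x.1 ≠ 0 := by have := (mem_Icc.1 hv).1; omega
      have hw0 : x.2 ≠ 0 := by have := (mem_Icc.1 hw).1; omega
      rw [if_pos (isEdge_of_bigD_le hy0 hv0 hw0 (hfeq _ hv) (hfeq _ hw) hD), hμ _ hv, hμ _ hw]
      have h1 := hN _ _ hv0 hw0 hω
      have h2 := hf0 x.1
      have h3 := hf0 x.2
      calc _ = y ^ 2 * ((f x.1 * Nat.totient x.1) * (f x.2 * Nat.totient x.2)) * 1 := by ring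
        _ ≤ y ^ 2 * ((f x.1 * Nat.totient x.1) * (f x.2 * Nat.totient x.2)) *
            (t ^ (-(C + 1)) * A ^ N x.1 x.2) := by gcongr
        _ = _ := by ring
    · obtain ⟨hv, hw⟩ := mem_product.1 (mem_filter.1 hx).1
      exact mem_product.2 ⟨hsub hv, hsub hw⟩
  have hpow : mass H f ^ s * mass H f ^ s ≤ bigPsi ψ Q ^ (1 + ε) * y ^ (-(1 + ε)) := by
    have hm0 : 0 ≤ mass H f := mass_nonneg hf0
    rw [← Real.rpow_add' hm0 (by rw [hs]; linarith), hs, add_halves, Real.rpow_neg hy0.le,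
      ← Real.inv_rpow hy0.le, ← Real.mul_rpow hΨ0 (by positivity)]
    refine Real.rpow_le_rpow hm0 ?_ (by linarith)
    rw [hmass, ← div_eq_mul_inv]
    gcongr
    linarith
  have hm2 : 0 ≤ mass H f ^ s * mass H f ^ s := by
    have := Real.rpow_nonneg (mass_nonneg hf0 (H := H)) s
    positivity
  have hprod0 : 0 ≤ ∏ p ∈ S, (1 + K / p) := prod_nonneg fun p _ => by positivity
  have ht1 : t ^ (-(C + 1)) * t = t ^ (-C) := by
    nth_rewrite 2 [← Real.rpow_one t]
    rw [← Real.rpow_add ht0]; congr 1; ring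
  have hy2 : y ^ 2 * y ^ (-(1 + ε)) = y ^ (1 - ε) := by
    rw [← Real.rpow_two, ← Real.rpow_add hy0]; congr 1; ring
  calc _ ≤ _ := hsum
    _ ≤ y ^ 2 * t ^ (-(C + 1)) * (B * (t * Real.exp (K * (c + p₀))) *
        (bigPsi ψ Q ^ (1 + ε) * y ^ (-(1 + ε)))) := by
        refine mul_le_mul_of_nonneg_left (hE.trans ?_) (by positivity)
        gcongr
    _ = B * Real.exp (K * (c + p₀)) * (t ^ (-(C + 1)) * t) * (y ^ 2 * y ^ (-(1 + ε))) *
        bigPsi ψ Q ^ (1 + ε) := by ring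
    _ = _ := by rw [ht1, hy2]

end
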